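/- Theorem 1.8. Let $\mathcal M$ be a regular matroid with finite ground set $E$, represented by a totally unimodular real matrix $M$ with columns indexed by $E$. Terminology. A signed circuit (resp. signed cocircuit) is a $\{0,\pm1\}$-vector in $\ker M$ (resp. in $\operatorname{im} M^T$) whose support is a circuit (resp. cocircuit) of $\mathcal M$. Each edge $e\in E$ has two opposite arcs $\pm\vec e$; signed circuits and cocircuits are viewed as sets of arcs. A fourientation $F$ is a set of arcs, $-F$ is the set of its reversed arcs and $F^c$ its complement. An edge is bioriented in $F$ if both its arcs are in $F$, and one-way oriented if exactly one is; an orientation is a fourientation in which every edge is one-way oriented. A potential circuit of $F$ is a signed circuit contained in $F$; a potential cocircuit of $F$ is a signed cocircuit contained in $-(F^c)$. A circuit (resp. cocircuit) reversal replaces in an orientation $O$ a signed circuit (resp. cocircuit) contained in $O$ by its opposite; circuit reversal classes, cocircuit reversal classes and circuit-cocircuit reversal classes $[O]$ are the classes of the equivalence relations on orientations generated by circuit reversals, by cocircuit reversals, and by both. An external atlas $\mathcal A$ assigns to each basis $B$ a fourientation $\vec B$ in which the edges in $B$ are bioriented and those not in $B$ are one-way oriented; an internal atlas $\mathcal A^*$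 assigns to each basis $B$ a fourientation $\vec{B^*}$ in which the edges not in $B$ are bioriented and those in $B$ are one-way oriented. Put $f_{\mathcal A,\mathcal A^*}(B)=\vec B\cap\vec{B^*}$, an orientation. The atlas $\mathcal A$ is dissecting (resp. triangulating) if for any two distinct bases $B_1,B_2$ the fourientation $\vec{B_1}\cap(-\vec{B_2})$ has a potential cocircuit (resp. has no potential circuit). The atlas $\mathcal A^*$ is dissecting (resp. triangulating) if for any two distinct bases $B_1,B_2$ the fourientation $(\vec{B_1^*}\cap(-\vec{B_2^*}))^c$ has a potential circuit (resp. has no potential cocircuit). Theorem. Let $\mathcal A$ and $\mathcal A^*$ both be dissecting, and suppose that at least one of them is triangulating. Then for every orientation $O$ there is a unique basis $B$ with $f_{\mathcal A,\mathcal A^*}(B)\in[O]$. The orientation $O$ can be obtained from $f_{\mathcal A,\mathcal A^*}(B)$ by reversing signed circuits $\{\vec{C_i}\}_{i\in I}$ and signed cocircuits $\{\vec{C_j^*}\}_{j\in J}$ contained in $f_{\mathcal A,\mathcal A^*}(B)$ whose supports $C_i$, $C_j^*$ are all pairwise disjoint, and the set $$\varphi_{\mathcal A,\mathcal A^*}(O)=\Big(B\cup\biguplus_{i\in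 I}C_i\Big)\setminus\biguplus_{j\in J}C_j^*$$ does not depend on the choice of these signed circuits and cocircuits. Moreover: (1) $\varphi_{\mathcal A,\mathcal A^*}$ is a bijection from the orientations of $\mathcal M$ to the subsets of $E$. It is in fact tiling: for any two distinct orientations $O_1,O_2$ there is an edge $e$ on which $O_1$ and $O_2$ differ and which lies in the symmetric difference $\varphi_{\mathcal A,\mathcal A^*}(O_1)\bigtriangleup\varphi_{\mathcal A,\mathcal A^*}(O_2)$. (2) The image under $\varphi_{\mathcal A,\mathcal A^*}^{-1}$ of the set of independent sets of $\mathcal M$ contains exactly one orientation from each circuit reversal class. (3) The image under $\varphi_{\mathcal A,\mathcal A^*}^{-1}$ of the set of spanning sets of $\mathcal M$ contains exactly one orientation from each cocircuit reversal class. -/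

import Mathlib

open scoped Matrix

namespace RegularMatroid

/-- The real matrix `M` represents the matroid `N` on the ground set `E` (all of the type `E`):
a set of edges is independent iff the corresponding family of columns is linearly independent. -/
def Represents {E m : Type*} (M : Matrix m E ℝ) (N : Matroid E) : Prop :=
  N.E = Set.univ ∧ ∀ I : Set E, N.Indep I ↔ LinearIndepOn ℝ M.col I

/-- All entries are `0`, `1` or `-1`. -/
def IsSignVector {E : Type*} (v : E → ℝ) : Prop :=
  ∀ e, v e = 0 ∨ v e = 1 ∨ v e = -1

/-- A signed circuit: a `{0, ±1}`-vector in `ker M` whose support is a circuit. -/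
def IsSignedCircuit {E m : Type*} [Fintype E] (M : Matrix m E ℝ) (N : Matroid E)
    (v : E → ℝ) : Prop :=
  IsSignVector v ∧ M *ᵥ v = 0 ∧ N.IsCircuit (Function.support v)

/-- A signed cocircuit: a `{0, ±1}`-vector in `im Mᵀ` whose support is a cocircuit. -/
def IsSignedCocircuit {E m : Type*} [Fintype m] (M : Matrix m E ℝ) (N : Matroid E)
    (v : E → ℝ) : Prop :=
  IsSignVector v ∧ (∃ u : m → ℝ, Mᵀ *ᵥ u = v) ∧ N.IsCocircuit (Function.support v)

/-- An arc: an edge together with a sign; `(e, s)` stands for the vector with `e`-th entry `s`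
and all other entries zero. -/
abbrev Arc (E : Type*) : Type _ := E × ℤˣ

/-- A fourientation is an arbitrary set of arcs. -/
abbrev Fourientation (E : Type*) : Type _ := Set (Arc E)

/-- The set of arcs of a `{0, ±1}`-vector. -/
def arcs {E : Type*} (v : E → ℝ) : Fourientation E :=
  {a | v a.1 = ((a.2 : ℤ) : ℝ)}

/-- The fourientation `-F`, with all arcs reversed. -/
def rev {E : Type*} (F : Fourientation E) : Fourientation E :=
  {a | (a.1, -a.2) ∈ F}

/-- The restriction of `F` to a single edge `e`. -/
def restrict {E : Type*} (F : Fourientation E) (e : E) : Fourientation E :=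
  {a | a ∈ F ∧ a.1 = e}

/-- Exactly one of the two arcs of `e` is in `F`. -/
def OneWay {E : Type*} (F : Fourientation E) (e : E) : Prop :=
  ∃! s : ℤˣ, (e, s) ∈ F

/-- Both arcs of `e` are in `F`. -/
def Bioriented {E : Type*} (F : Fourientation E) (e : E) : Prop :=
  ∀ s : ℤˣ, (e, s) ∈ F

/-- An orientation: a set of arcs in which each edge appears exactly once. -/
def Orientation (E : Type*) : Type _ :=
  {O : Fourientation E // ∀ e, OneWay O e}

/-- `v` is a potential circuit of `F`: a signed circuit contained in `F`. -/
def IsPotentialCircuit {E m : Type*} [Fintype E] (M : Matrix m E ℝ) (N : Matroid E)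
    (F : Fourientation E) (v : E → ℝ) : Prop :=
  IsSignedCircuit M N v ∧ arcs v ⊆ F

/-- `v` is a potential cocircuit of `F`: a signed cocircuit contained in `-Fᶜ`. -/
def IsPotentialCocircuit {E m : Type*} [Fintype m] (M : Matrix m E ℝ) (N : Matroid E)
    (F : Fourientation E) (v : E → ℝ) : Prop :=
  IsSignedCocircuit M N v ∧ arcs v ⊆ rev Fᶜ

/-- The bases of a matroid. -/
abbrev Base {E : Type*} (N : Matroid E) : Type _ := {B : Set E // N.IsBase B}

/-- An external atlas: for each basis `B`, a fourientation in which the edges in `B` are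
bioriented and the edges outside `B` are one-way oriented. -/
structure ExternalAtlas {E : Type*} (N : Matroid E) where
  /-- the externally oriented basis attached to a basis -/
  fou : Base N → Fourientation E
  internal : ∀ B : Base N, ∀ e ∈ B.1, Bioriented (fou B) e
  external : ∀ B : Base N, ∀ e ∉ B.1, OneWay (fou B) e

/-- An internal atlas: for each basis `B`, a fourientation in which the edges outside `B` are
bioriented and the edges in `B` are one-way oriented. -/
structure InternalAtlas {E : Type*} (N : Matroid E) where
  /-- the internally oriented basis attached to a basis -/
  fou : Base N → Fourientation E
  internal : ∀ B : Base N, ∀ e ∈ B.1, OneWay (fou B) e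
  external : ∀ B : Base N, ∀ e ∉ B.1, Bioriented (fou B) e

def ExternalAtlas.Dissecting {E m : Type*} [Fintype m] {N : Matroid E}
    (A : ExternalAtlas N) (M : Matrix m E ℝ) : Prop :=
  ∀ B₁ B₂ : Base N, B₁ ≠ B₂ → ∃ v, IsPotentialCocircuit M N (A.fou B₁ ∩ rev (A.fou B₂)) v

def ExternalAtlas.Triangulating {E m : Type*} [Fintype E] {N : Matroid E}
    (A : ExternalAtlas N) (M : Matrix m E ℝ) : Prop :=
  ∀ B₁ B₂ : Base N, B₁ ≠ B₂ → ¬ ∃ v, IsPotentialCircuit M N (A.fou B₁ ∩ rev (A.fou B₂)) v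

def InternalAtlas.Dissecting {E m : Type*} [Fintype E] {N : Matroid E}
    (A : InternalAtlas N) (M : Matrix m E ℝ) : Prop :=
  ∀ B₁ B₂ : Base N, B₁ ≠ B₂ → ∃ v, IsPotentialCircuit M N (A.fou B₁ ∩ rev (A.fou B₂))ᶜ v

def InternalAtlas.Triangulating {E m : Type*} [Fintype m] {N : Matroid E}
    (A : InternalAtlas N) (M : Matrix m E ℝ) : Prop :=
  ∀ B₁ B₂ : Base N, B₁ ≠ B₂ → ¬ ∃ v, IsPotentialCocircuit M N (A.fou B₁ ∩ rev (A.fou B₂))ᶜ v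

/-- The map sending a basis `B` to the orientation that is the intersection of the two oriented
bases attached to `B`. -/
def basisMap {E : Type*} {N : Matroid E} (A : ExternalAtlas N) (A' : InternalAtlas N)
    (B : Base N) : Orientation E :=
  ⟨A.fou B ∩ A'.fou B, fun e => by
    by_cases he : e ∈ B.1
    · obtain ⟨s, hs, hu⟩ := A'.internal B e he
      exact ⟨s, ⟨A.internal B e he s, hs⟩, fun t ht => hu t ht.2⟩
    · obtain ⟨s, hs, hu⟩ := A.external B e he
      exact ⟨s, ⟨hs, A'.external B e he s⟩, fun t ht => hu t ht.1⟩⟩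

/-- `O₂` arises from `O₁` by replacing a signed circuit in `O₁` by its opposite. -/
def CircuitReversal {E m : Type*} [Fintype E] (M : Matrix m E ℝ) (N : Matroid E)
    (O₁ O₂ : Orientation E) : Prop :=
  ∃ v, IsSignedCircuit M N v ∧ arcs v ⊆ O₁.1 ∧ O₂.1 = (O₁.1 \ arcs v) ∪ arcs (-v)

/-- `O₂` arises from `O₁` by replacing a signed cocircuit in `O₁` by its opposite. -/
def CocircuitReversal {E m : Type*} [Fintype m] (M : Matrix m E ℝ) (N : Matroid E)
    (O₁ O₂ : Orientation E) : Prop :=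
  ∃ v, IsSignedCocircuit M N v ∧ arcs v ⊆ O₁.1 ∧ O₂.1 = (O₁.1 \ arcs v) ∪ arcs (-v)

/-- The two orientations are in the same circuit reversal class. -/
def SameCircuitClass {E m : Type*} [Fintype E] (M : Matrix m E ℝ) (N : Matroid E) :
    Orientation E → Orientation E → Prop :=
  Relation.EqvGen (CircuitReversal M N)

/-- The two orientations are in the same cocircuit reversal class. -/
def SameCocircuitClass {E m : Type*} [Fintype m] (M : Matrix m E ℝ) (N : Matroid E) :
    Orientation E → Orientation E → Prop :=
  Relation.EqvGen (CocircuitReversal M N)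

/-- The two orientations are in the same circuit-cocircuit reversal class. -/
def SameCircuitCocircuitClass {E m : Type*} [Fintype E] [Fintype m] (M : Matrix m E ℝ)
    (N : Matroid E) : Orientation E → Orientation E → Prop :=
  Relation.EqvGen fun O₁ O₂ => CircuitReversal M N O₁ O₂ ∨ CocircuitReversal M N O₁ O₂

/-- `O₂` is obtained from `O₁` by simultaneously reversing the signed circuits in `𝒞` and the
signed cocircuits in `𝒟`, all of them in `O₁` and with pairwise disjoint underlying edges. -/
structure DifferBy {E m : Type*} [Fintype E] [Fintype m] (M : Matrix m E ℝ) (N : Matroid E)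
    (O₁ O₂ : Orientation E) (𝒞 𝒟 : Set (E → ℝ)) : Prop where
  circuit : ∀ v ∈ 𝒞, IsSignedCircuit M N v ∧ arcs v ⊆ O₁.1
  cocircuit : ∀ v ∈ 𝒟, IsSignedCocircuit M N v ∧ arcs v ⊆ O₁.1
  disjoint_circuits : 𝒞.PairwiseDisjoint Function.support
  disjoint_cocircuits : 𝒟.PairwiseDisjoint Function.support
  disjoint_circuit_cocircuit :
    ∀ v ∈ 𝒞, ∀ w ∈ 𝒟, Disjoint (Function.support v) (Function.support w)
  eq : O₂.1 = (O₁.1 \ ⋃ v ∈ 𝒞 ∪ 𝒟, arcs v) ∪ ⋃ v ∈ 𝒞 ∪ 𝒟, arcs (-v)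

/-- `S = (B ∪ ⋃ C_i) \ ⋃ C_j^*` for some basis `B` whose associated orientation is in the
circuit-cocircuit reversal class of `O`, and some disjoint signed circuits `C_i` and signed
cocircuits `C_j^*` whose reversal turns that orientation into `O`. -/
def IsExtendedValue {E m : Type*} [Fintype E] [Fintype m] (M : Matrix m E ℝ) {N : Matroid E}
    (A : ExternalAtlas N) (A' : InternalAtlas N) (O : Orientation E) (S : Set E) : Prop :=
  ∃ (B : Base N) (𝒞 𝒟 : Set (E → ℝ)),
    SameCircuitCocircuitClass M N (basisMap A A' B) O ∧
    DifferBy M N (basisMap A A' B) O 𝒞 𝒟 ∧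
    S = (B.1 ∪ ⋃ v ∈ 𝒞, Function.support v) \ ⋃ v ∈ 𝒟, Function.support v

/-- Any two distinct orientations differ on an edge of the symmetric difference of their images. -/
def Tiling {E : Type*} (φ : Orientation E → Set E) : Prop :=
  ∀ O₁ O₂ : Orientation E, O₁ ≠ O₂ →
    ∃ e, restrict O₁.1 e ≠ restrict O₂.1 e ∧ e ∈ symmDiff (φ O₁) (φ O₂)

/-- `S` contains exactly one element of each class of the equivalence relation `R`. -/
def IsRepresentativeSet {α : Type*} (R : α → α → Prop) (S : Set α) : Prop :=
  ∀ x, ∃! y, y ∈ S ∧ R x y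

end RegularMatroid

/-! Orientations are read as ±1-vectors, with `V = ker M` and `W = im Mᵀ`. Only a few facts about
`V` and `W` matter, and `RegularPair` records them: they are orthogonal complements, they represent
the matroid and its dual, and their vectors supported on circuits, resp. cocircuits, rescale to sign
vectors. These facts are self-dual, so each statement about circuits also serves for cocircuits.

Shape of a class. The edges of an orientation split into a part covered by a positive vector of `V`
and a part covered by one of `W`, and reversals preserve this splitting. Hence equivalent
orientations differ by `2c + 2d`, where `c ∈ V` and `d ∈ W` are disjoint sign vectors contained in
the first one (`RegularPair.exists_reversible`); such vectors decompose into disjoint signed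
circuits and cocircuits.

Separation. Let `O₁`, `O₂` arise from distinct bases `B₁`, `B₂` by reversing `(c₁, d₁)` and `(c₂,
d₂)`, and suppose no edge separates them. If the external atlas is triangulating, the dissecting
internal atlas provides a signed circuit `C`, and Farkas' lemma turns triangulation into a vector `w
∈ W` with entries at most 1 in absolute value. Then `C/2 + (c₁ - c₂)` and `w/2 + (d₂ - d₁)` are
orthogonal, yet their product is nonnegative on each edge. So every product vanishes, which forces
the support of `C` into `B₁ ∩ B₂`, a contradiction (`RegularPair.not_tile`). The other case is dual,
and for equal bases the same argument runs without `C` and `w` (`RegularPair.eq_of_tile`). The case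
`O₁ = O₂` shows that distinct bases give distinct classes and that the extended map is well defined.

Counting. For a generic weight `g`, a maximizer of `o ⬝ᵥ g` in a class is determined, through linear
programming duality, by a basis; so there are at most as many classes as bases
(`RegularPair.exists_base_invariant`), and every class is hit. Tiling implies injectivity, and there
are as many orientations as subsets. Finally, the image of an orientation is independent iff `c = 0`
and spanning iff `d = 0`; representatives are unique because `V ∩ W = 0`. -/

namespace RegularMatroid

/-! ### Farkas' lemma and conformal vectors -/

/-- **Farkas' lemma** for finitely many linear functionals on a real vector space. -/
theorem farkas {X ι : Type*} [AddCommGroup X] [Module ℝ X] (s : Finset ι) :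
    ∀ (a : ι → X →ₗ[ℝ] ℝ) (b : X →ₗ[ℝ] ℝ),
      (∀ x, (∀ i ∈ s, 0 ≤ a i x) → 0 ≤ b x) →
      ∃ c : ι → ℝ, (∀ i, 0 ≤ c i) ∧ b = ∑ i ∈ s, c i • a i := by
  classical
  induction s using Finset.induction_on with
  | empty =>
    intro a b h
    refine ⟨0, fun _ => le_rfl, ?_⟩
    ext x
    have h1 := h x (by simp)
    have h2 := h (-x) (by simp)
    simp only [map_neg] at h2
    simp only [Finset.sum_empty, LinearMap.zero_apply]
    linarith
  | insert j s hj ih =>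
    intro a b h
    by_cases hb : ∀ x, (∀ i ∈ s, 0 ≤ a i x) → 0 ≤ b x
    · obtain ⟨c, hc, hbc⟩ := ih a b hb
      refine ⟨Function.update c j 0, fun i => ?_, ?_⟩
      · by_cases hi : i = j
        · subst hi; simp
        · simpa [hi] using hc i
      · rw [Finset.sum_insert hj, hbc]
        simp only [Function.update_self, zero_smul, zero_add]
        exact Finset.sum_congr rfl fun i hi => by
          rw [Function.update_of_ne (by rintro rfl; exact hj hi)]
    -- Constraint `j` is not redundant: some `x` satisfies the others but has `b x < 0`, hence `a j
    -- x < 0`. Projecting along `x` onto the kernel of `a j` eliminates this constraint.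
    · push Not at hb
      obtain ⟨x, hx, hbx⟩ := hb
      have hjx : a j x < 0 := by
        by_contra hjx
        refine absurd (h x fun i hi => ?_) (not_le.2 hbx)
        rcases Finset.mem_insert.1 hi with rfl | hi
        · exact not_lt.1 hjx
        · exact hx i hi
      obtain ⟨c, hc, hbc⟩ := ih (fun i => a i - (a i x / a j x) • a j)
        (b - (b x / a j x) • a j) (fun y hy => by
          have h1 := h (y - (a j y / a j x) • x) (fun i hi => by
            rcases Finset.mem_insert.1 hi with rfl | hi
            · simp [hjx.ne]
            · have := hy i hi
              simp only [LinearMap.sub_apply, LinearMap.smul_apply, smul_eq_mul] at this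
              simp only [map_sub, map_smul, smul_eq_mul]
              calc _ ≤ _ := this
                _ = _ := by ring)
          simp only [map_sub, map_smul, smul_eq_mul] at h1
          simp only [LinearMap.sub_apply, LinearMap.smul_apply, smul_eq_mul]
          calc _ ≤ _ := h1
            _ = _ := by ring)
      have hd : 0 ≤ b x / a j x - ∑ i ∈ s, c i * (a i x / a j x) := by
        have h1 : 0 ≤ b x / a j x := div_nonneg_of_nonpos hbx.le hjx.le
        have h2 : ∑ i ∈ s, c i * (a i x / a j x) ≤ 0 := Finset.sum_nonpos fun i hi =>
          mul_nonpos_of_nonneg_of_nonpos (hc i) (div_nonpos_of_nonneg_of_nonpos (hx i hi) hjx.le)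
        linarith
      refine ⟨Function.update c j (b x / a j x - ∑ i ∈ s, c i * (a i x / a j x)), fun i => ?_, ?_⟩
      · by_cases hi : i = j
        · subst hi; simpa using hd
        · simpa [hi] using hc i
      · rw [Finset.sum_insert hj]
        have h3 : ∑ i ∈ s, Function.update c j (b x / a j x - ∑ i ∈ s, c i * (a i x / a j x)) i • a i
            = ∑ i ∈ s, c i • a i := Finset.sum_congr rfl fun i hi => by
          rw [Function.update_of_ne (by rintro rfl; exact hj hi)]
        rw [h3, Function.update_self]
        ext y
        have h4 := LinearMap.congr_fun hbc y
        simp only [LinearMap.sub_apply, LinearMap.smul_apply, smul_eq_mul, LinearMap.sum_apply,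
          LinearMap.add_apply, mul_sub, Finset.sum_sub_distrib] at h4 ⊢
        have h5 : ∑ i ∈ s, c i * (a i x / a j x * a j y)
            = (∑ i ∈ s, c i * (a i x / a j x)) * a j y := by
          rw [Finset.sum_mul]; exact Finset.sum_congr rfl fun i _ => by ring
        rw [h5] at h4
        linarith

/-- Every nonzero vector of a subspace has a conformal vector of minimal support. -/
theorem exists_conformal_minimal {E : Type*} [Fintype E] (V : Submodule ℝ (E → ℝ)) :
    ∀ v ∈ V, v ≠ 0 → ∃ c ∈ V, c ≠ 0 ∧ (∀ e, c e ≠ 0 → 0 < c e * v e) ∧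
      ∀ c' ∈ V, Function.support c' ⊂ Function.support c → c' = 0 := by
  classical
  suffices H : ∀ n : ℕ, ∀ v ∈ V, v ≠ 0 → (Function.support v).ncard = n →
      ∃ c ∈ V, c ≠ 0 ∧ (∀ e, c e ≠ 0 → 0 < c e * v e) ∧
      ∀ c' ∈ V, Function.support c' ⊂ Function.support c → c' = 0 from
    fun v hv h0 => H _ v hv h0 rfl
  intro n
  induction n using Nat.strong_induction_on with
  | _ n ih =>
    intro v hv h0 hn
    by_cases hmin : ∀ c' ∈ V, Function.support c' ⊂ Function.support v → c' = 0
    · exact ⟨v, hv, h0, fun e he => mul_self_pos.2 he, hmin⟩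
    push Not at hmin
    obtain ⟨u, huV, hus, hu0⟩ := hmin
    obtain ⟨u, huV, hus, e₀, he₀⟩ : ∃ u ∈ V, Function.support u ⊂ Function.support v ∧
        ∃ e, 0 < u e * v e := by
      obtain ⟨e, he⟩ := Function.ne_iff.1 hu0
      have hve : v e ≠ 0 := hus.1 he
      rcases lt_or_gt_of_ne (mul_ne_zero he hve) with h | h
      · exact ⟨-u, V.neg_mem huV, by simpa using hus, e, by simpa using h⟩
      · exact ⟨u, huV, hus, e, h⟩
    obtain ⟨e₁, he₁, hmin⟩ := Finset.exists_min_image (Finset.univ.filter fun e => 0 < u e * v e)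
      (fun e => v e / u e) ⟨e₀, by simpa using he₀⟩
    simp only [Finset.mem_filter, Finset.mem_univ, true_and] at he₁ hmin
    -- The largest `t` for which `v - t • u` stays conformal to `v`: the entry at `e₁` vanishes, and
    -- no sign has changed before.
    set t := v e₁ / u e₁ with ht
    have hu1 : u e₁ ≠ 0 := by rintro h; simp [h] at he₁
    have htpos : 0 < t := by
      rw [ht, show v e₁ / u e₁ = (u e₁ * v e₁) / (u e₁ * u e₁) by field_simp]
      exact div_pos he₁ (mul_self_pos.2 hu1)
    have hconf : ∀ e, (v - t • u) e ≠ 0 → 0 < (v - t • u) e * v e := by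
      intro e he
      simp only [Pi.sub_apply, Pi.smul_apply, smul_eq_mul] at he ⊢
      have hve : v e ≠ 0 := by
        intro h
        have : u e = 0 := by
          by_contra h'
          exact hus.1 h' h
        simp [h, this] at he
      have : 0 ≤ (v e - t * u e) * v e := by
        rcases le_or_gt (u e * v e) 0 with h | h
        · nlinarith [mul_self_nonneg (v e), mul_nonneg htpos.le (neg_nonneg.2 h)]
        · have h2 := hmin e h
          have hue : u e ≠ 0 := by rintro h'; simp [h'] at h
          have h3 : t * (u e * v e) ≤ v e / u e * (u e * v e) :=
            mul_le_mul_of_nonneg_right h2 h.le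
          have h4 : v e / u e * (u e * v e) = v e * v e := by field_simp
          nlinarith
      exact lt_of_le_of_ne this (mul_ne_zero he hve).symm
    have hsub : Function.support (v - t • u) ⊂ Function.support v := by
      refine ⟨fun e he h => ?_, fun h => ?_⟩
      · have := hconf e he
        simp [h] at this
      · have : e₁ ∈ Function.support v := by
          intro h; simp [h] at he₁
        apply h this
        simp [ht, hu1]
    obtain ⟨e₂, he₂, he₂'⟩ := Set.exists_of_ssubset hus
    have hne : v - t • u ≠ 0 := by
      intro h
      have := congrFun h e₂
      have h2 : u e₂ = 0 := by simpa using he₂'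
      simp [h2] at this
      exact he₂ this
    obtain ⟨c, hcV, hc0, hcc, hcm⟩ := ih _ (hn ▸ Set.ncard_lt_ncard hsub (Set.toFinite _))
      (v - t • u) (V.sub_mem hv (V.smul_mem t huV)) hne rfl
    refine ⟨c, hcV, hc0, fun e he => ?_, hcm⟩
    have h1 := hcc e he
    have h2 := hconf e (by intro h; simp only [h, mul_zero, lt_self_iff_false] at h1)
    have h3 : 0 < ((v - t • u) e * (v - t • u) e) * (c e * v e) := by
      nlinarith [mul_pos h1 h2]
    exact (pos_iff_pos_of_mul_pos h3).1 (mul_self_pos.2 (by intro h; simp only [h, mul_zero, lt_self_iff_false] at h1))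

/-! ### Unimodular spaces and regular pairs -/

/-- `V` is a subspace whose minimal supports are the circuits of `N`, all of them supports of
`{0, ±1}`-vectors. -/
structure UnimodularSpace {E : Type*} (N : Matroid E) (V : Submodule ℝ (E → ℝ)) : Prop where
  ground : N.E = Set.univ
  indep_iff : ∀ I : Set E, N.Indep I ↔ ∀ v ∈ V, Function.support v ⊆ I → v = 0
  unimodular : ∀ v ∈ V, N.IsCircuit (Function.support v) → ∃ t : ℝ, 0 < t ∧ IsSignVector (t • v)

/-- `V` and `W` are orthogonal complements of each other which represent the circuits and the
cocircuits of `N`. -/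
structure RegularPair {E : Type*} [Fintype E] (N : Matroid E) (V W : Submodule ℝ (E → ℝ)) :
    Prop where
  left : UnimodularSpace N V
  right : UnimodularSpace N✶ W
  mem_left : ∀ v, v ∈ V ↔ ∀ w ∈ W, v ⬝ᵥ w = 0
  mem_right : ∀ w, w ∈ W ↔ ∀ v ∈ V, w ⬝ᵥ v = 0

theorem RegularPair.dual {E : Type*} [Fintype E] {N : Matroid E} {V W : Submodule ℝ (E → ℝ)}
    (h : RegularPair N V W) : RegularPair N✶ W V :=
  ⟨h.right, by rw [Matroid.dual_dual]; exact h.left, h.mem_right, h.mem_left⟩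

/-- A `{0, ±1}`-vector of `V` whose support is a circuit. -/
structure SignedCircuitIn {E : Type*} (N : Matroid E) (V : Submodule ℝ (E → ℝ)) (v : E → ℝ) :
    Prop where
  sign : IsSignVector v
  mem : v ∈ V
  circuit : N.IsCircuit (Function.support v)

theorem SignedCircuitIn.ne_zero {E : Type*} {N : Matroid E} {V : Submodule ℝ (E → ℝ)} {v : E → ℝ}
    (h : SignedCircuitIn N V v) : v ≠ 0 := by
  rintro rfl
  exact N.empty_not_isCircuit (by simpa using h.circuit)

theorem IsSignVector.neg {E : Type*} {v : E → ℝ} (h : IsSignVector v) : IsSignVector (-v) := by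
  intro e
  rcases h e with h | h | h <;> simp [h]

theorem SignedCircuitIn.neg {E : Type*} {N : Matroid E} {V : Submodule ℝ (E → ℝ)} {v : E → ℝ}
    (h : SignedCircuitIn N V v) : SignedCircuitIn N V (-v) :=
  ⟨h.sign.neg, V.neg_mem h.mem, by simpa using h.circuit⟩

/-- A conformal vector of minimal support is supported on a circuit, and unimodularity rescales it,
by a positive factor, to a sign vector. -/
theorem UnimodularSpace.exists_conformal {E : Type*} [Fintype E] {N : Matroid E}
    {V : Submodule ℝ (E → ℝ)} (h : UnimodularSpace N V) {v : E → ℝ} (hv : v ∈ V) (h0 : v ≠ 0) :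
    ∃ c, SignedCircuitIn N V c ∧ ∀ e, c e ≠ 0 → 0 < c e * v e := by
  obtain ⟨c, hcV, hc0, hcc, hcm⟩ := exists_conformal_minimal V v hv h0
  have hcirc : N.IsCircuit (Function.support c) := by
    rw [Matroid.isCircuit_iff_forall_ssubset]
    refine ⟨⟨fun hi => hc0 ((h.indep_iff _).1 hi c hcV le_rfl), by simp [h.ground]⟩, fun I hI => ?_⟩
    rw [h.indep_iff]
    exact fun v hv hvI => hcm v hv (lt_of_le_of_lt hvI hI)
  obtain ⟨t, ht, hs⟩ := h.unimodular c hcV hcirc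
  refine ⟨t • c, ⟨hs, V.smul_mem t hcV, ?_⟩, fun e he => ?_⟩
  · rwa [Function.support_const_smul_of_ne_zero _ _ ht.ne']
  · have := hcc e (by intro h; simp [h] at he)
    simp only [Pi.smul_apply, smul_eq_mul]
    nlinarith [mul_pos ht this]

theorem UnimodularSpace.not_indep {E : Type*} {N : Matroid E}
    {V : Submodule ℝ (E → ℝ)} (h : UnimodularSpace N V) {v : E → ℝ} (hv : v ∈ V) (h0 : v ≠ 0)
    {I : Set E} (hI : Function.support v ⊆ I) : ¬ N.Indep I :=
  fun hi => h0 ((h.indep_iff I).1 hi v hv hI)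

end RegularMatroid

/-! ### The regular pair of a totally unimodular matrix -/

namespace RegularMatroid

theorem exists_submatrix_det_ne_zero {m J : Type*} [Fintype m] [Fintype J] [DecidableEq J]
    (A : Matrix m J ℝ) (hA : LinearIndependent ℝ A.col) :
    ∃ r : J → m, (A.submatrix r id).det ≠ 0 := by
  have h1 : A.rank = Fintype.card J := by
    rw [← Matrix.rank_transpose]
    exact LinearIndependent.rank_matrix hA
  rw [Matrix.rank_eq_finrank_span_row] at h1
  obtain ⟨f, hf, -, hli⟩ := Submodule.exists_fun_fin_finrank_span_eq ℝ (Set.range A.row)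
  choose r hr using hf
  let e : J ≃ Fin _ := Fintype.equivFinOfCardEq h1.symm
  refine ⟨r ∘ e, ?_⟩
  have h2 : LinearIndependent ℝ (A.submatrix (r ∘ e) id).row := by
    have h3 : (A.submatrix (r ∘ e) id).row = f ∘ e := funext fun j => hr (e j)
    rw [h3]
    exact hli.comp e e.injective
  rw [Matrix.linearIndependent_rows_iff_isUnit, Matrix.isUnit_iff_isUnit_det] at h2
  exact h2.ne_zero

/-- Cramer's rule on a nonsingular square set of rows: a coefficient is a quotient of two minors,
both in `{0, ±1}`. -/
theorem _root_.Matrix.IsTotallyUnimodular.coeff_eq {E m J : Type*} [Fintype m] [Fintype J]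
    {M : Matrix m E ℝ} (hM : M.IsTotallyUnimodular) (g : J → E)
    (hg : LinearIndependent ℝ (fun j => M.col (g j))) (f : E) (x : J → ℝ)
    (hx : ∀ i, ∑ j, M i (g j) * x j = M i f) (j : J) : x j = 0 ∨ x j = 1 ∨ x j = -1 := by
  classical
  obtain ⟨r, hr⟩ := exists_submatrix_det_ne_zero (M.submatrix id g) hg
  set A := M.submatrix r g with hA
  have hA' : (M.submatrix id g).submatrix r id = A := rfl
  rw [hA'] at hr
  have h1 : A *ᵥ x = fun i => M (r i) f := funext fun i => hx (r i)
  have h2 : A.cramer (fun i => M (r i) f) = A.det • x := by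
    rw [← h1, Matrix.cramer_eq_adjugate_mulVec, Matrix.mulVec_mulVec, Matrix.adjugate_mul,
      Matrix.smul_mulVec, Matrix.one_mulVec]
  have h3 := congrFun h2 j
  rw [Matrix.cramer_apply] at h3
  have h4 : A.updateCol j (fun i => M (r i) f) = M.submatrix r (Function.update g j f) := by
    ext i k
    by_cases hk : k = j
    · subst hk; simp
    · simp [hk, hA]
  rw [h4] at h3
  rw [Matrix.isTotallyUnimodular_iff_fintype] at hM
  obtain ⟨s, hs⟩ := hM J r g
  obtain ⟨s', hs'⟩ := hM J r (Function.update g j f)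
  rw [← hs', Pi.smul_apply, smul_eq_mul] at h3
  rw [← hA] at hs
  rw [← hs] at h3 hr
  cases s <;> cases s' <;> simp at h3 hr <;> grind

section

variable {E m : Type*} [Fintype E] (M : Matrix m E ℝ) (N : Matroid E)

theorem indep_iff_ker (hMN : Represents M N) (I : Set E) :
    N.Indep I ↔ ∀ v ∈ LinearMap.ker M.mulVecLin, Function.support v ⊆ I → v = 0 := by
  rw [hMN.2 I, linearIndepOn_iff]
  have key : ∀ l : E →₀ ℝ, Finsupp.linearCombination ℝ M.col l = M *ᵥ l := by
    intro l
    ext i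
    rw [Finsupp.linearCombination_apply, Finsupp.sum_fintype _ _ (by simp)]
    simp [Matrix.mulVec, dotProduct, Matrix.col, mul_comm]
  constructor
  · intro h v hv hvI
    have := h (Finsupp.equivFunOnFinite.symm v) (by
      rw [Finsupp.mem_supported]
      intro e he
      exact hvI (by simpa using he)) (by rw [key]; simpa using hv)
    ext e
    simpa using DFunLike.congr_fun this e
  · intro h l hl h0
    rw [key] at h0
    have := h l (by simpa using h0) (by
      rw [Finsupp.mem_supported] at hl
      simpa using hl)
    exact DFunLike.coe_injective this

variable [Fintype m]

/-- Solving a circuit relation for one column `f` writes it in terms of the independent remaining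
columns, so by `coeff_eq` every ratio `v e / v f` is `0` or `±1`. -/
theorem unimodularSpace_ker (hM : M.IsTotallyUnimodular) (hMN : Represents M N) :
    UnimodularSpace N (LinearMap.ker M.mulVecLin) := by
  classical
  refine ⟨hMN.1, indep_iff_ker M N hMN, fun v hv hc => ?_⟩
  obtain ⟨f, hf⟩ := hc.nonempty
  have hf0 : v f ≠ 0 := hf
  have hi := hc.sdiff_singleton_indep hf
  rw [hMN.2] at hi
  have hcoeff := hM.coeff_eq (J := ↥(Function.support v \ {f})) (fun j => j.1) hi f
    (fun j => - v j.1 / v f) (fun i => by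
      have h1 : ∑ e, M i e * v e = 0 := by
        have h2 : M *ᵥ v = 0 := by simpa using hv
        exact congrFun h2 i
      have h2 : ∑ e, M i e * v e = M i f * v f
          + ∑ e ∈ Finset.univ.filter (· ∈ Function.support v \ {f}), M i e * v e := by
        rw [← Finset.add_sum_erase _ _ (Finset.mem_univ f)]
        congr 1
        symm
        apply Finset.sum_subset
        · intro e he
          simpa using (Finset.mem_filter.1 he).2.2
        · intro e he he'
          have : v e = 0 := by
            by_contra h
            simp at he he'
            exact he (he' h)
          simp [this]
      have h3 : ∑ e ∈ Finset.univ.filter (· ∈ Function.support v \ {f}), M i e * v e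
          = ∑ j : ↥(Function.support v \ {f}), M i j.1 * v j.1 :=
        Finset.sum_subtype _ (by simp) _
      have h4 : ∑ j : ↥(Function.support v \ {f}), M i j.1 * (-v j.1 / v f)
          = -(∑ j : ↥(Function.support v \ {f}), M i j.1 * v j.1) / v f := by
        rw [← Finset.sum_neg_distrib, Finset.sum_div]
        exact Finset.sum_congr rfl fun j _ => by ring
      rw [h4, ← h3]
      rw [h2] at h1
      rw [div_eq_iff hf0]
      linarith)
  refine ⟨|v f|⁻¹, inv_pos.2 (abs_pos.2 hf0), fun e => ?_⟩
  have key : v e / v f = 0 ∨ v e / v f = 1 ∨ v e / v f = -1 := by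
    by_cases hef : e = f
    · subst hef; simp [hf0]
    by_cases hev : v e = 0
    · simp [hev]
    have := hcoeff ⟨e, hev, hef⟩
    simp only [neg_div] at this
    rcases this with h | h | h
    · left; linarith
    · right; right; linarith
    · right; left; linarith
  simp only [Pi.smul_apply, smul_eq_mul]
  rcases abs_choice (v f) with h | h <;> rw [h]
  · rw [inv_mul_eq_div]; exact key
  · rw [inv_mul_eq_div, div_neg]
    rcases key with h | h | h <;> simp [h]

theorem mem_ker_iff_orthogonal (v : E → ℝ) :
    v ∈ LinearMap.ker M.mulVecLin ↔ ∀ w ∈ LinearMap.range Mᵀ.mulVecLin, v ⬝ᵥ w = 0 := by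
  simp only [LinearMap.mem_ker, LinearMap.mem_range, Matrix.mulVecLin_apply]
  constructor
  · rintro h _ ⟨u, rfl⟩
    rw [Matrix.dotProduct_mulVec, Matrix.vecMul_transpose, h, zero_dotProduct]
  · intro h
    rw [← dotProduct_self_eq_zero]
    have := h _ ⟨M *ᵥ v, rfl⟩
    rwa [Matrix.dotProduct_mulVec, Matrix.vecMul_transpose] at this

theorem mem_range_iff_orthogonal (w : E → ℝ) :
    w ∈ LinearMap.range Mᵀ.mulVecLin ↔ ∀ v ∈ LinearMap.ker M.mulVecLin, w ⬝ᵥ v = 0 := by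
  constructor
  · intro hw v hv
    rw [dotProduct_comm]
    exact (mem_ker_iff_orthogonal M v).1 hv w hw
  · intro h
    classical
    let L : (E → ℝ) → ((E → ℝ) →ₗ[ℝ] ℝ) := fun a => dotProductBilin ℝ ℝ a
    have hL : ∀ a b, L a b = a ⬝ᵥ b := fun a b => rfl
    have h1 : L w ∈ Submodule.span ℝ (Set.range fun i => L (M i)) := by
      apply mem_span_of_iInf_ker_le_ker
      intro v hv
      simp only [Submodule.mem_iInf, LinearMap.mem_ker] at hv ⊢
      exact h v (by
        simp only [LinearMap.mem_ker, Matrix.mulVecLin_apply]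
        exact funext fun i => hv i)
    rw [Submodule.mem_span_range_iff_exists_fun] at h1
    obtain ⟨u, hu⟩ := h1
    refine ⟨u, ?_⟩
    ext e
    have h2 := LinearMap.congr_fun hu (Pi.single e 1)
    simp only [LinearMap.sum_apply, LinearMap.smul_apply, hL, dotProduct_single, mul_one,
      smul_eq_mul] at h2
    rw [← h2]
    simp [Matrix.vecMul, dotProduct, mul_comm]

theorem coindep_iff_range (hMN : Represents M N) (I : Set E) :
    N✶.Indep I ↔ ∀ w ∈ LinearMap.range Mᵀ.mulVecLin, Function.support w ⊆ I → w = 0 := by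
  classical
  constructor
  · intro hI w hw hwI
    rw [Matroid.dual_indep_iff_exists'] at hI
    obtain ⟨-, B, hB, hd⟩ := hI
    by_contra hne
    obtain ⟨e, he⟩ := Function.ne_iff.1 hne
    have heB : e ∉ B := fun h => hd.le_bot ⟨hwI he, h⟩
    -- The fundamental circuit of `e` with respect to `B` meets the support of `w` only in `e`,
    -- against orthogonality.
    have hdep := (hB.insert_dep ⟨by simp [hMN.1], heB⟩).not_indep
    rw [indep_iff_ker M N hMN] at hdep
    push Not at hdep
    obtain ⟨v, hv, hvs, hv0⟩ := hdep
    have h1 := (mem_ker_iff_orthogonal M v).1 hv w hw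
    rw [dotProduct, Finset.sum_eq_single e] at h1
    · rcases mul_eq_zero.1 h1 with h | h
      · refine hv0 ((indep_iff_ker M N hMN B).1 hB.indep v hv fun f hf => ?_)
        rcases hvs hf with rfl | h'
        · exact absurd h hf
        · exact h'
      · exact he h
    · intro f _ hf
      by_cases hvf : v f = 0
      · simp [hvf]
      have : w f = 0 := by
        by_contra hwf
        rcases hvs hvf with h | h
        · exact hf h
        · exact hd.le_bot ⟨hwI hwf, h⟩
      simp [this]
    · simp
  · intro h
    obtain ⟨J, hJ⟩ := N.exists_isBasis Iᶜ (by simp [hMN.1])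
    have hJi := hJ.indep
    rw [Matroid.dual_indep_iff_exists']
    refine ⟨by simp [hMN.1], J, ?_, Set.disjoint_left.2 fun e he h' => hJ.subset h' he⟩
    by_contra hnb
    obtain ⟨B, hB, hJB⟩ := hJi.exists_isBase_superset
    obtain ⟨e, heB, heJ⟩ := Set.exists_of_ssubset
      (hJB.ssubset_of_ne (by rintro rfl; exact hnb hB))
    have hspan : ∀ f, ¬ N.Indep (insert f J) → M.col f ∈ Submodule.span ℝ (M.col '' J) := by
      intro f hf
      by_contra hs
      rw [hMN.2] at hf hJi
      exact hf (hJi.insert hs)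
    have hens : M.col e ∉ Submodule.span ℝ (M.col '' J) := by
      have h1 := hB.indep.subset (Set.insert_subset heB hJB)
      rw [hMN.2] at h1
      exact ((linearIndepOn_insert heJ).1 h1).2
    -- A functional on the column space that vanishes on `J`, hence on all columns outside `I`, but
    -- not on `e`, yields a nonzero row-space vector supported in `I`.
    obtain ⟨φ, hφe, hφ⟩ := Submodule.exists_le_ker_of_notMem hens
    have hw : Mᵀ *ᵥ (fun i => φ (Pi.single i 1)) = fun f => φ (M.col f) := by
      ext f
      have : M.col f = ∑ i, M i f • (Pi.single i 1 : m → ℝ) := by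
        ext i
        simp [Matrix.col, Pi.single_apply, Finset.sum_apply]
      rw [this, map_sum]
      simp [Matrix.mulVec, dotProduct]
    have h0 := h (fun f => φ (M.col f)) ⟨_, hw⟩ (fun f hf => by
      by_contra hfI
      refine hf (hφ ?_)
      by_cases hfJ : f ∈ J
      · exact Submodule.subset_span ⟨f, hfJ, rfl⟩
      · exact hspan f (hJ.insert_dep ⟨hfI, hfJ⟩).not_indep)
    exact hφe (congrFun h0 e)

/-- Unimodularity of the row space is inherited from the kernel: if `B` avoids the cocircuit except
for `e`, the fundamental circuit of another cocircuit element `f` can meet it only in `e` and `f`,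
and orthogonality to its sign vector makes the two entries of `w` equal up to sign. -/
theorem regularPair_of_isTotallyUnimodular (hM : M.IsTotallyUnimodular) (hMN : Represents M N) :
    RegularPair N (LinearMap.ker M.mulVecLin) (LinearMap.range Mᵀ.mulVecLin) := by
  have hV := unimodularSpace_ker M N hM hMN
  refine ⟨hV, ⟨hMN.1, coindep_iff_range M N hMN, fun w hw hc => ?_⟩,
    mem_ker_iff_orthogonal M, mem_range_iff_orthogonal M⟩
  obtain ⟨e, he⟩ := hc.nonempty
  have hi := hc.sdiff_singleton_indep he
  rw [Matroid.dual_indep_iff_exists'] at hi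
  obtain ⟨-, B, hB, hd⟩ := hi
  refine ⟨|w e|⁻¹, inv_pos.2 (abs_pos.2 he), fun f => ?_⟩
  have key : w f / w e = 0 ∨ w f / w e = 1 ∨ w f / w e = -1 := by
    by_cases hf0 : w f = 0
    · simp [hf0]
    by_cases hfe : f = e
    · subst hfe; simp [hf0]
    have hfB : f ∉ B := fun h => hd.le_bot ⟨⟨hf0, hfe⟩, h⟩
    have hdep := (hB.insert_dep ⟨by simp [hMN.1], hfB⟩).not_indep
    rw [hV.indep_iff] at hdep
    push Not at hdep
    obtain ⟨v, hv, hvs, hv0⟩ := hdep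
    obtain ⟨c, hc, hcv⟩ := hV.exists_conformal hv hv0
    have hcs : Function.support c ⊆ insert f B := fun g hg => hvs fun h => by
      have := hcv g hg
      simp [h] at this
    have hcf : c f ≠ 0 := by
      intro h
      refine hc.ne_zero ((hV.indep_iff B).1 hB.indep c hc.mem fun g hg => ?_)
      rcases hcs hg with rfl | h'
      · exact absurd h hg
      · exact h'
    have h1 := (mem_ker_iff_orthogonal M c).1 hc.mem w hw
    have h2 : ∀ g, g ≠ e ∧ g ≠ f → c g * w g = 0 := by
      rintro g ⟨hge, hgf⟩
      by_contra h
      obtain ⟨hcg, hwg⟩ := mul_ne_zero_iff.1 h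
      rcases hcs hcg with h' | h'
      · exact hgf h'
      · exact hd.le_bot ⟨⟨hwg, hge⟩, h'⟩
    rw [dotProduct, Fintype.sum_eq_add e f (Ne.symm hfe) h2] at h1
    have he0 : w e ≠ 0 := he
    rcases hc.sign f with h | h | h
    · exact absurd h hcf
    all_goals
      rw [h] at h1
      have h3 : w f = (if c f = 1 then -c e else c e) * w e := by
        rw [h]; norm_num; linarith
      rw [h3, mul_div_assoc, div_self he0, mul_one]
      rcases hc.sign e with h' | h' | h' <;> split_ifs <;> simp [h']
  simp only [Pi.smul_apply, smul_eq_mul]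
  rcases abs_choice (w e) with h | h <;> rw [h]
  · rw [inv_mul_eq_div]; exact key
  · rw [inv_mul_eq_div, div_neg]
    rcases key with h | h | h <;> simp [h]

end

end RegularMatroid

/-! ### Cyclic parts and the shape of a reversal class -/

namespace RegularMatroid

variable {E : Type*} {N : Matroid E} {V W : Submodule ℝ (E → ℝ)}

theorem RegularPair.dotProduct_eq_zero [Fintype E] (h : RegularPair N V W) {v w : E → ℝ} (hv : v ∈ V)
    (hw : w ∈ W) : v ⬝ᵥ w = 0 :=
  (h.mem_left v).1 hv w hw

/-- A form of Farkas' lemma for a pair of orthogonal subspaces. -/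
theorem RegularPair.exists_mem_right [Fintype E] (h : RegularPair N V W) (s : E → ℝ) {P Z : Set E}
    (hPZ : Disjoint P Z) {e : E}    (he : e ∈ P) (hse : s e ≠ 0)
    (hV : ∀ v ∈ V, (∀ f ∈ Z, v f = 0) → (∀ f ∈ P, 0 ≤ s f * v f) → s e * v e ≤ 0) :
    ∃ w ∈ W, (∀ f ∈ P, 0 ≤ s f * w f) ∧ (∀ f, f ∉ P → f ∉ Z → w f = 0) ∧ 0 < s e * w e := by
  classical
  -- Two opposite inequalities encode an equation on `Z`; on `P` both copies are the sign condition,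
  -- elsewhere they are void.
  let κ : E × Bool → ℝ := fun i =>
    if i.1 ∈ P then s i.1 else if i.1 ∈ Z then (if i.2 then 1 else -1) else 0
  let ev : E → (V →ₗ[ℝ] ℝ) := fun f => (LinearMap.proj f).comp V.subtype
  have hev : ∀ f (v : V), ev f v = v.1 f := fun f v => rfl
  obtain ⟨c, hc, hb⟩ := farkas Finset.univ (fun i : E × Bool => κ i • ev i.1) (-(s e • ev e))
    (fun v hv => by
      have h1 : ∀ i : E × Bool, 0 ≤ κ i * v.1 i.1 := fun i => hv i (Finset.mem_univ _)
      have hP : ∀ f ∈ P, 0 ≤ s f * v.1 f := fun f hf => by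
        have := h1 (f, true)
        simpa [κ, hf] using this
      have := hV v.1 v.2 (fun f hf => by
        have hfP : f ∉ P := fun hfP => hPZ.le_bot ⟨hfP, hf⟩
        have h2 := h1 (f, true)
        have h3 := h1 (f, false)
        simp [κ, hf, hfP] at h2 h3
        linarith) hP
      simpa [hev] using this)
  -- The Farkas identity on `V`, with `-(s e • ev e)` moved to the other side, says that this vector
  -- is orthogonal to `V`. The extra term `s e` makes the inequality at `e` strict.
  refine ⟨fun f => ∑ b, c (f, b) * κ (f, b) + if f = e then s e else 0, ?_, ?_, ?_, ?_⟩
  · rw [h.mem_right]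
    intro v hv
    have h1 := LinearMap.congr_fun hb ⟨v, hv⟩
    simp only [LinearMap.neg_apply, LinearMap.smul_apply, hev, smul_eq_mul, LinearMap.sum_apply,
      Fintype.sum_prod_type] at h1
    simp only [dotProduct, add_mul, Finset.sum_add_distrib, ite_mul, zero_mul,
      Finset.sum_ite_eq', Finset.mem_univ, if_true, Finset.sum_mul]
    simp only [mul_assoc]
    linarith
  · intro f hf
    have h1 : 0 ≤ c (f, true) := hc _
    have h2 : 0 ≤ c (f, false) := hc _
    simp only [Fintype.sum_bool, κ, hf, if_true]
    split_ifs with hfe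
    · subst hfe
      nlinarith [mul_nonneg h1 (mul_self_nonneg (s f)), mul_nonneg h2 (mul_self_nonneg (s f)),
        mul_self_nonneg (s f)]
    · nlinarith [mul_nonneg h1 (mul_self_nonneg (s f)), mul_nonneg h2 (mul_self_nonneg (s f))]
  · intro f hf hf'
    have hfe : f ≠ e := by rintro rfl; exact hf he
    simp [κ, hf, hf', hfe]
  · have h1 : 0 ≤ c (e, true) := hc _
    have h2 : 0 ≤ c (e, false) := hc _
    simp only [Fintype.sum_bool, κ, he, if_true]
    nlinarith [mul_nonneg h1 (mul_self_nonneg (s e)), mul_nonneg h2 (mul_self_nonneg (s e)),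
        mul_self_pos.2 hse]

/-- A vector all of whose entries are `1` or `-1`. -/
def IsOrient (o : E → ℝ) : Prop := ∀ e, o e = 1 ∨ o e = -1

theorem IsOrient.ne_zero {o : E → ℝ} (ho : IsOrient o) (e : E) : o e ≠ 0 := by
  rcases ho e with h | h <;> simp [h]

/-- A set `P` of edges such that the edges in `P` are covered by a positive vector of `V`, the
others by one of `W`. -/
def IsCyclicPart (V W : Submodule ℝ (E → ℝ)) (o : E → ℝ) (P : Set E) : Prop :=
  ∃ v ∈ V, ∃ w ∈ W, (∀ e ∈ P, 0 < o e * v e ∧ w e = 0) ∧ (∀ e ∉ P, 0 < o e * w e ∧ v e = 0)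

theorem IsCyclicPart.dual {o : E → ℝ} {P : Set E} (h : IsCyclicPart V W o P) :
    IsCyclicPart W V o Pᶜ := by
  obtain ⟨v, hv, w, hw, h1, h2⟩ := h
  exact ⟨w, hw, v, hv, h2, fun e he => h1 e (by simpa using he)⟩

/-- By Farkas each edge is covered by a nonnegative (relative to `o`) vector of `V` or of `W`. Sum
these over all edges; orthogonality makes the two sums have disjoint supports. -/
theorem RegularPair.exists_isCyclicPart [Fintype E] (h : RegularPair N V W) {o : E → ℝ} (ho : IsOrient o) :
    ∃ P, IsCyclicPart V W o P := by
  classical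
  have key : ∀ e, ∃ v ∈ V, ∃ w ∈ W, (∀ f, 0 ≤ o f * v f) ∧ (∀ f, 0 ≤ o f * w f) ∧
      (0 < o e * v e ∨ 0 < o e * w e) := by
    intro e
    by_cases hv : ∃ v ∈ V, (∀ f, 0 ≤ o f * v f) ∧ 0 < o e * v e
    · obtain ⟨v, hv, h1, h2⟩ := hv
      exact ⟨v, hv, 0, W.zero_mem, h1, by simp, Or.inl h2⟩
    · push Not at hv
      obtain ⟨w, hw, h1, -, h2⟩ := h.exists_mem_right o (disjoint_bot_right (a := Set.univ)) (Set.mem_univ e) (ho.ne_zero e)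
        (fun v hv' _ h1 => hv v hv' fun f => h1 f (Set.mem_univ f))
      exact ⟨0, V.zero_mem, w, hw, by simp, fun f => h1 f (Set.mem_univ f), Or.inr h2⟩
  choose v hv w hw hvn hwn hvw using key
  have hVs : ∑ f, v f ∈ V := V.sum_mem fun f _ => hv f
  have hWs : ∑ f, w f ∈ W := W.sum_mem fun f _ => hw f
  have hvn' : ∀ e, 0 ≤ o e * (∑ f, v f) e := fun e => by
    rw [Finset.sum_apply, Finset.mul_sum]
    exact Finset.sum_nonneg fun f _ => hvn f e
  have hwn' : ∀ e, 0 ≤ o e * (∑ f, w f) e := fun e => by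
    rw [Finset.sum_apply, Finset.mul_sum]
    exact Finset.sum_nonneg fun f _ => hwn f e
  have hvw' : ∀ e, 0 < o e * (∑ f, v f) e ∨ 0 < o e * (∑ f, w f) e := fun e => by
    simp only [Finset.sum_apply, Finset.mul_sum]
    exact (hvw e).imp
      (fun h => Finset.sum_pos' (fun f _ => hvn f e) ⟨e, Finset.mem_univ e, h⟩)
      (fun h => Finset.sum_pos' (fun f _ => hwn f e) ⟨e, Finset.mem_univ e, h⟩)
  have hprod : ∀ e, (∑ f, v f) e * (∑ f, w f) e = 0 := by
    have h0 := h.dotProduct_eq_zero hVs hWs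
    rw [dotProduct, Finset.sum_eq_zero_iff_of_nonneg] at h0
    · exact fun e => h0 e (Finset.mem_univ e)
    · intro e _
      have := mul_nonneg (hvn' e) (hwn' e)
      rcases ho e with h | h <;> simpa [h] using this
  refine ⟨{e | 0 < o e * (∑ f, v f) e}, _, hVs, _, hWs, fun e he => ⟨he, ?_⟩, fun e he => ?_⟩
  · rcases mul_eq_zero.1 (hprod e) with h1 | h1
    · simp only [Set.mem_ofPred_eq, h1, mul_zero, lt_self_iff_false] at he
    · exact h1
  · have h2 := (hvw' e).resolve_left he
    refine ⟨h2, (mul_eq_zero.1 (hprod e)).resolve_right ?_⟩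
    intro h1
    simp only [h1, mul_zero, lt_self_iff_false] at h2

/-- Reversal of a signed circuit, on the level of `±1`-vectors. -/
def CircuitStep (N : Matroid E) (V : Submodule ℝ (E → ℝ)) (o o' : E → ℝ) : Prop :=
  ∃ c, SignedCircuitIn N V c ∧ (∀ e, c e ≠ 0 → c e = o e) ∧ o' = o - (2 : ℝ) • c

theorem CircuitStep.symm {o o' : E → ℝ} (h : CircuitStep N V o o') : CircuitStep N V o' o := by
  obtain ⟨c, hc, hco, rfl⟩ := h
  refine ⟨-c, hc.neg, fun e he => ?_, by simp⟩
  have := hco e (by simpa using he)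
  simp only [Pi.neg_apply, Pi.sub_apply, Pi.smul_apply, smul_eq_mul]
  linarith

theorem CircuitStep.sub_mem {o o' : E → ℝ} (h : CircuitStep N V o o') : o - o' ∈ V := by
  obtain ⟨c, hc, hco, rfl⟩ := h
  simpa using V.smul_mem 2 hc.mem

/-- A signed circuit contained in `o` is orthogonal to the vector of `W` that is positive exactly
off `P`, so it lives inside `P`. -/
theorem IsCyclicPart.of_circuitStep [Fintype E] (h : RegularPair N V W) {o o' : E → ℝ}
    (ho : IsOrient o) {P : Set E} (hP : IsCyclicPart V W o P) (hs : CircuitStep N V o o') :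
    IsCyclicPart V W o' P ∧ ∃ c ∈ V, (∀ e ∉ P, c e = 0) ∧ o' = o - (2 : ℝ) • c := by
  classical
  obtain ⟨v, hv, w, hw, h1, h2⟩ := hP
  obtain ⟨c, hc, hco, rfl⟩ := hs
  have hcP : ∀ e ∉ P, c e = 0 := by
    have h0 := h.dotProduct_eq_zero hc.mem hw
    rw [dotProduct, Finset.sum_eq_zero_iff_of_nonneg] at h0
    · intro e he
      by_contra hce
      have h3 := h0 e (Finset.mem_univ e)
      have h4 := (h2 e he).1
      rw [hco e hce] at h3
      exact h4.ne' h3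
    · intro e _
      by_cases hce : c e = 0
      · simp [hce]
      by_cases he : e ∈ P
      · simp [(h1 e he).2]
      · rw [hco e hce]; exact (h2 e he).1.le
  refine ⟨?_, c, hc.mem, hcP, rfl⟩
  -- With `K` larger than all entries of `v`, subtracting `K • c` flips the sign of `v` exactly on
  -- the reversed edges.
  obtain ⟨K, hK⟩ : ∃ K : ℝ, ∀ e, |v e| < K := by
    refine ⟨∑ e, |v e| + 1, fun e => ?_⟩
    have := Finset.single_le_sum (f := fun e => |v e|) (fun e _ => abs_nonneg (v e))
      (Finset.mem_univ e)
    linarith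
  refine ⟨v - K • c, V.sub_mem hv (V.smul_mem K hc.mem), w, hw, fun e he => ⟨?_, (h1 e he).2⟩,
    fun e he => ?_⟩
  · have h3 := (h1 e he).1
    have h4 := abs_lt.1 (hK e)
    simp only [Pi.sub_apply, Pi.smul_apply, smul_eq_mul]
    by_cases hce : c e = 0
    · simpa [hce] using h3
    · rw [hco e hce]
      rcases ho e with h | h <;> rw [h] <;> linarith [h4.1, h4.2]
  · have h3 := h2 e he
    simpa [hcP e he] using h3

/-- Reversal of a signed circuit or of a signed cocircuit. -/
def Step (N : Matroid E) (V W : Submodule ℝ (E → ℝ)) (o o' : E → ℝ) : Prop :=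
  CircuitStep N V o o' ∨ CircuitStep N✶ W o o'

theorem Step.symm {o o' : E → ℝ} (h : Step N V W o o') : Step N V W o' o :=
  h.imp CircuitStep.symm CircuitStep.symm

theorem CircuitStep.isOrient {o o' : E → ℝ} (h : CircuitStep N V o o') (ho : IsOrient o) :
    IsOrient o' := by
  obtain ⟨c, hc, hco, rfl⟩ := h
  intro e
  simp only [Pi.sub_apply, Pi.smul_apply, smul_eq_mul]
  by_cases hce : c e = 0
  · simpa [hce] using ho e
  · rw [hco e hce]
    rcases ho e with h | h <;> rw [h] <;> norm_num

theorem Step.isOrient {o o' : E → ℝ} (h : Step N V W o o') (ho : IsOrient o) : IsOrient o' :=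
  h.elim (fun h => h.isOrient ho) (fun h => h.isOrient ho)

theorem IsCyclicPart.of_step [Fintype E] (h : RegularPair N V W) {o o' : E → ℝ}
    (ho : IsOrient o) {P : Set E} (hP : IsCyclicPart V W o P) (hs : Step N V W o o') :
    IsCyclicPart V W o' P ∧ ∃ c ∈ V, ∃ d ∈ W, (∀ e ∉ P, c e = 0) ∧ (∀ e ∈ P, d e = 0) ∧
      o' = o - (2 : ℝ) • c - (2 : ℝ) • d := by
  rcases hs with hs | hs
  · obtain ⟨h1, c, hc, hcP, h2⟩ := hP.of_circuitStep h ho hs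
    exact ⟨h1, c, hc, 0, W.zero_mem, hcP, by simp, by simpa using h2⟩
  · obtain ⟨h1, c, hc, hcP, h2⟩ := hP.dual.of_circuitStep h.dual ho hs
    exact ⟨by simpa using h1.dual, 0, V.zero_mem, c, hc, by simp, by simpa using hcP,
      by simpa using h2⟩

theorem eqvGen_isOrient_iff {o o' : E → ℝ} (hs : Relation.EqvGen (Step N V W) o o') :
    IsOrient o ↔ IsOrient o' := by
  induction hs with
  | rel _ _ h => exact ⟨h.isOrient, h.symm.isOrient⟩
  | refl => rfl
  | symm _ _ _ ih => exact ih.symm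
  | trans _ _ _ _ _ ih ih' => exact ih.trans ih'

theorem eqvGen_isCyclicPart [Fintype E] (h : RegularPair N V W) {o o' : E → ℝ}
    (hs : Relation.EqvGen (Step N V W) o o') (P : Set E) :
    IsOrient o → (IsCyclicPart V W o P ↔ IsCyclicPart V W o' P) ∧ (IsCyclicPart V W o P →
      ∃ c ∈ V, ∃ d ∈ W, (∀ e ∉ P, c e = 0) ∧ (∀ e ∈ P, d e = 0) ∧
      o' = o - (2 : ℝ) • c - (2 : ℝ) • d) := by
  induction hs with
  | rel x y hxy =>
    intro ho
    exact ⟨⟨fun hx => (hx.of_step h ho hxy).1, fun hy => (hy.of_step h (hxy.isOrient ho) hxy.symm).1⟩,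
      fun hx => (hx.of_step h ho hxy).2⟩
  | refl => exact fun _ => ⟨Iff.rfl, fun _ => ⟨0, V.zero_mem, 0, W.zero_mem, by simp⟩⟩
  | symm x y hxy ih =>
    intro ho
    obtain ⟨h1, h2⟩ := ih ((eqvGen_isOrient_iff hxy).2 ho)
    refine ⟨h1.symm, fun hy => ?_⟩
    obtain ⟨c, hc, d, hd, hcP, hdP, rfl⟩ := h2 (h1.2 hy)
    refine ⟨-c, V.neg_mem hc, -d, W.neg_mem hd, by simpa using hcP, by simpa using hdP, ?_⟩
    module
  | trans x y z hxy hyz ih ih' =>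
    intro ho
    obtain ⟨h1, h2⟩ := ih ho
    obtain ⟨h3, h4⟩ := ih' ((eqvGen_isOrient_iff hxy).1 ho)
    refine ⟨h1.trans h3, fun hx => ?_⟩
    obtain ⟨c, hc, d, hd, hcP, hdP, rfl⟩ := h2 hx
    obtain ⟨c', hc', d', hd', hcP', hdP', rfl⟩ := h4 (h1.1 hx)
    refine ⟨c + c', V.add_mem hc hc', d + d', W.add_mem hd hd', fun e he => ?_, fun e he => ?_, ?_⟩
    · simp [hcP e he, hcP' e he]
    · simp [hdP e he, hdP' e he]
    · module

/-- `c` and `d` are sign vectors of `V` and `W` which are contained in the orientation `f` and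
have disjoint supports. -/
structure Reversible (V W : Submodule ℝ (E → ℝ)) (f c d : E → ℝ) : Prop where
  mem_left : c ∈ V
  mem_right : d ∈ W
  conf_left : ∀ e, c e ≠ 0 → c e = f e
  conf_right : ∀ e, d e ≠ 0 → d e = f e
  disj : ∀ e, c e = 0 ∨ d e = 0

theorem Reversible.dual {f c d : E → ℝ} (h : Reversible V W f c d) : Reversible W V f d c :=
  ⟨h.mem_right, h.mem_left, h.conf_right, h.conf_left, fun e => (h.disj e).symm⟩

/-- The total changes in `V` and `W` live on the cyclic part and on its complement. On each edge
only one of them acts, and since both orientations are ±1 there, it is `0` or agrees with `o`. -/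
theorem RegularPair.exists_reversible [Fintype E] (h : RegularPair N V W) {o o' : E → ℝ} (ho : IsOrient o)
    (hs : Relation.EqvGen (Step N V W) o o') :
    ∃ c d, Reversible V W o c d ∧ o' = o - (2 : ℝ) • c - (2 : ℝ) • d := by
  obtain ⟨P, hP⟩ := h.exists_isCyclicPart ho
  obtain ⟨c, hc, d, hd, hcP, hdP, rfl⟩ := (eqvGen_isCyclicPart h hs P ho).2 hP
  have ho' := (eqvGen_isOrient_iff hs).1 ho
  have hdisj : ∀ e, c e = 0 ∨ d e = 0 := fun e => by
    by_cases he : e ∈ P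
    · exact Or.inr (hdP e he)
    · exact Or.inl (hcP e he)
  refine ⟨c, d, ⟨hc, hd, fun e he => ?_, fun e he => ?_, hdisj⟩, rfl⟩
  · have h1 := ho' e
    simp only [Pi.sub_apply, Pi.smul_apply, smul_eq_mul, (hdisj e).resolve_left he] at h1
    rcases ho e with h | h <;> rcases h1 with h1 | h1 <;> first | linarith | (exfalso; apply he; linarith)
  · have h1 := ho' e
    simp only [Pi.sub_apply, Pi.smul_apply, smul_eq_mul, (hdisj e).resolve_right he] at h1
    rcases ho e with h | h <;> rcases h1 with h1 | h1 <;> first | linarith | (exfalso; apply he; linarith)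

/-- A sign vector is a sum of disjoint signed circuits. -/
theorem UnimodularSpace.exists_decomposition [Fintype E] (h : UnimodularSpace N V) :
    ∀ c ∈ V, IsSignVector c → ∀ o : E → ℝ, (∀ e, c e ≠ 0 → c e = o e) →
    (∃ 𝒞 : Set (E → ℝ), (∀ v ∈ 𝒞, SignedCircuitIn N V v ∧ ∀ e, v e ≠ 0 → v e = c e) ∧
      𝒞.PairwiseDisjoint Function.support ∧ (∀ e, c e ≠ 0 → ∃ v ∈ 𝒞, v e ≠ 0)) ∧
    Relation.EqvGen (CircuitStep N V) o (o - (2 : ℝ) • c) := by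
  suffices H : ∀ n : ℕ, ∀ c ∈ V, IsSignVector c → (Function.support c).ncard = n →
      ∀ o : E → ℝ, (∀ e, c e ≠ 0 → c e = o e) →
      (∃ 𝒞 : Set (E → ℝ), (∀ v ∈ 𝒞, SignedCircuitIn N V v ∧ ∀ e, v e ≠ 0 → v e = c e) ∧
      𝒞.PairwiseDisjoint Function.support ∧ (∀ e, c e ≠ 0 → ∃ v ∈ 𝒞, v e ≠ 0)) ∧
      Relation.EqvGen (CircuitStep N V) o (o - (2 : ℝ) • c) from
    fun v hv h0 => H _ v hv h0 rfl
  intro n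
  induction n using Nat.strong_induction_on with
  | _ n ih =>
    intro c hc hs hn o ho
    by_cases h0 : c = 0
    · subst h0
      exact ⟨⟨∅, by simp⟩, by simpa using Relation.EqvGen.refl o⟩
    obtain ⟨u, hu, huc⟩ := h.exists_conformal hc h0
    have hue : ∀ e, u e ≠ 0 → u e = c e := fun e he => by
      have h1 := huc e he
      rcases hu.sign e with h | h | h <;> rcases hs e with h' | h' | h' <;>
        simp only [h, h', ne_eq, not_true_eq_false] at h1 he ⊢ <;> norm_num at h1
    have hsub : ∀ e, (c - u) e ≠ 0 → u e = 0 := fun e he => by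
      by_contra h'
      exact he (by simp [hue e h'])
    have hss : Function.support (c - u) ⊂ Function.support c := by
      obtain ⟨e, he⟩ := Function.ne_iff.1 hu.ne_zero
      refine (Set.ssubset_iff_of_subset fun f hf hcf => ?_).2 ⟨e, ?_, fun h' => he (hsub e h')⟩
      · have := hsub f hf
        exact hf (by simp [this, hcf])
      · have := hue e he
        exact fun h' => he (this.trans h')
    have hval : ∀ e, (c - u) e ≠ 0 → (c - u) e = c e := fun e he => by
      simp [hsub e he]
    obtain ⟨⟨𝒞, h1, h2, h3⟩, h4⟩ := ih _ (hn ▸ Set.ncard_lt_ncard hss (Set.toFinite _)) (c - u)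
      (V.sub_mem hc hu.mem) (fun e => by
        by_cases he : (c - u) e = 0
        · exact Or.inl he
        · rw [hval e he]; exact hs e) rfl (o - (2 : ℝ) • u) (fun e he => by
        have := hsub e he
        rw [hval e he, ho e (by rw [← hval e he]; exact he)]
        simp [this])
    constructor
    · refine ⟨insert u 𝒞, ?_, ?_, ?_⟩
      · rintro v (rfl | hv)
        · exact ⟨hu, hue⟩
        · refine ⟨(h1 v hv).1, fun e he => ?_⟩
          have := (h1 v hv).2 e he
          rw [this, hval]
          rwa [← this]
      · refine h2.insert fun v hv _ => Set.disjoint_left.2 fun e he he' => he ?_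
        exact hsub e (by rw [← (h1 v hv).2 e he']; exact he')
      · intro e he
        by_cases hue' : u e = 0
        · obtain ⟨v, hv, hve⟩ := h3 e (by simpa [hue'] using he)
          exact ⟨v, Or.inr hv, hve⟩
        · exact ⟨u, Or.inl rfl, hue'⟩
    · refine Relation.EqvGen.trans _ (o - (2 : ℝ) • u) _ (Relation.EqvGen.rel _ _
        ⟨u, hu, fun e he => ?_, rfl⟩) ?_
      · rw [hue e he, ho e (by rw [← hue e he]; exact he)]
      · convert h4 using 1
        module

end RegularMatroid

/-! ### Generic weights and linear programming: at most one class per basis -/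

namespace RegularMatroid

variable {E : Type*} {N : Matroid E} {V W : Submodule ℝ (E → ℝ)}

theorem finite_isSignVector [Fintype E] : {v : E → ℝ | IsSignVector v}.Finite := by
  refine (Set.Finite.pi' (t := fun _ : E => ({0, 1, -1} : Set ℝ)) fun _ => by simp).subset ?_
  intro v hv e
  simpa using hv e

/-- A real vector space is not a finite union of proper subspaces, and there are only finitely many
sign vectors. -/
theorem exists_generic [Fintype E] :
    ∃ g : E → ℝ, ∀ v : E → ℝ, IsSignVector v → v ≠ 0 → v ⬝ᵥ g ≠ 0 := by
  classical
  let K : (E → ℝ) → Submodule ℝ (E → ℝ) := fun v => LinearMap.ker (dotProductBilin ℝ ℝ v)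
  have hK : ∀ v g, g ∈ K v ↔ v ⬝ᵥ g = 0 := fun v g => Iff.rfl
  have hfin := (finite_isSignVector (E := E)).subset
    (show {v | IsSignVector v ∧ v ≠ 0} ⊆ _ from fun v hv => hv.1)
  have := Subspace.biUnion_ne_univ_of_top_notMem (s := hfin.toFinset.image K) (by
    intro h
    obtain ⟨v, hv, hvt⟩ := Finset.mem_image.1 h
    simp only [Set.Finite.mem_toFinset, Set.mem_ofPred_eq] at hv
    have h1 : v ∈ K v := hvt ▸ Submodule.mem_top
    exact hv.2 (dotProduct_self_eq_zero.1 ((hK v v).1 h1)))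
  obtain ⟨g, hg⟩ := (Set.ne_univ_iff_exists_notMem _).1 this
  refine ⟨g, fun v hv h0 h => hg ?_⟩
  simp only [Set.mem_iUnion]
  exact ⟨K v, Finset.mem_image.2 ⟨v, by simpa using ⟨hv, h0⟩, rfl⟩, (hK v g).2 h⟩

-- Such a `z` is peeled into nonnegative multiples of signed circuits contained in `o`, each step
-- clearing an entry where `|z|` is least on the circuit.
set_option linter.unnecessarySeqFocus false in
theorem UnimodularSpace.dotProduct_nonneg [Fintype E] (h : UnimodularSpace N V) {o g : E → ℝ}
    (ho : IsOrient o)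
    (hC : ∀ c, SignedCircuitIn N V c → (∀ e, c e ≠ 0 → c e = o e) → 0 ≤ c ⬝ᵥ g) :
    ∀ z ∈ V, (∀ e, 0 ≤ o e * z e) → 0 ≤ z ⬝ᵥ g := by
  classical
  suffices H : ∀ n : ℕ, ∀ z ∈ V, (Function.support z).ncard = n → (∀ e, 0 ≤ o e * z e) →
      0 ≤ z ⬝ᵥ g from fun z hz => H _ z hz rfl
  intro n
  induction n using Nat.strong_induction_on with
  | _ n ih =>
    intro z hz hn hoz
    by_cases h0 : z = 0
    · simp [h0]
    obtain ⟨c, hc, hcz⟩ := h.exists_conformal hz h0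
    have hco : ∀ e, c e ≠ 0 → c e = o e := fun e he => by
      have h1 := hcz e he
      have h2 := hoz e
      rcases hc.sign e with h | h | h
      · exact absurd h he
      all_goals
        rcases ho e with h' | h' <;> (rw [h] at h1 ⊢; rw [h'] at h2 ⊢) <;> linarith
    obtain ⟨e₁, he₁, hmin⟩ := Finset.exists_min_image (Finset.univ.filter fun e => c e ≠ 0)
      (fun e => o e * z e) (by
        obtain ⟨e, he⟩ := Function.ne_iff.1 hc.ne_zero
        exact ⟨e, by simpa using he⟩)
    simp only [Finset.mem_filter, Finset.mem_univ, true_and] at he₁ hmin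
    have hoo : ∀ e, o e * o e = 1 := fun e => by rcases ho e with h | h <;> simp [h]
    have hz' : ∀ e, 0 ≤ o e * (z - (o e₁ * z e₁) • c) e := by
      intro e
      simp only [Pi.sub_apply, Pi.smul_apply, smul_eq_mul]
      by_cases hce : c e = 0
      · simpa [hce] using hoz e
      · have := hmin e hce
        have h2 : o e * (z e - o e₁ * z e₁ * c e) = o e * z e - o e₁ * z e₁ * (o e * o e) := by
          rw [hco e hce]; ring
        rw [h2, hoo]
        linarith
    have hss : Function.support (z - (o e₁ * z e₁) • c) ⊂ Function.support z := by
      refine (Set.ssubset_iff_of_subset fun e he hze => ?_).2 ⟨e₁, ?_, ?_⟩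
      · apply he
        have : c e = 0 := by
          by_contra hce
          have := hcz e hce
          simp [hze] at this
        simp [hze, this]
      · intro hze
        have := hcz e₁ he₁
        simp [hze] at this
      · have h2 : z e₁ - o e₁ * z e₁ * c e₁ = z e₁ * (1 - o e₁ * o e₁) := by
          rw [hco e₁ he₁]; ring
        simp [h2, hoo]
    have h1 := ih _ (hn ▸ Set.ncard_lt_ncard hss (Set.toFinite _)) _
      (V.sub_mem hz (V.smul_mem _ hc.mem)) rfl hz'
    rw [sub_dotProduct, smul_dotProduct, smul_eq_mul] at h1
    have := mul_nonneg (hoz e₁) (hC c hc hco)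
    linarith

/-- Strong duality for the linear program given by the weight `g` and the orientation `o`. -/
theorem RegularPair.exists_optimal [Fintype E] (h : RegularPair N V W) {o g : E → ℝ}
    (ho : IsOrient o)
    (hC : ∀ c, SignedCircuitIn N V c → (∀ e, c e ≠ 0 → c e = o e) → 0 ≤ c ⬝ᵥ g)
    (hD : ∀ c, SignedCircuitIn N✶ W c → (∀ e, c e ≠ 0 → c e = o e) → 0 ≤ c ⬝ᵥ g) :
    ∃ x y, x - g ∈ V ∧ y - g ∈ W ∧ (∀ e, 0 ≤ o e * x e) ∧ (∀ e, 0 ≤ o e * y e) ∧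
      ∀ e, x e = 0 ∨ y e = 0 := by
  classical
  have hoo : ∀ e, o e * o e = 1 := fun e => by rcases ho e with h | h <;> simp [h]
  have hmul : ∀ (x y : E → ℝ), (∀ e, 0 ≤ o e * x e) → (∀ e, 0 ≤ o e * y e) →
      ∀ e, 0 ≤ x e * y e := fun x y hx hy e => by
    have := mul_nonneg (hx e) (hy e)
    have h2 : o e * x e * (o e * y e) = (o e * o e) * (x e * y e) := by ring
    rwa [h2, hoo, one_mul] at this
  -- Orthogonality makes `x ⬝ᵥ y` affine in the unknowns `k = x - g` and `r = y - g`, so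
  -- complementarity, as `x ⬝ᵥ y ≤ 0`, is a linear constraint.
  have hexp : ∀ k ∈ V, ∀ r ∈ W, (g + k) ⬝ᵥ (g + r) = g ⬝ᵥ g + k ⬝ᵥ g + r ⬝ᵥ g := by
    intro k hk r hr
    rw [add_dotProduct, dotProduct_add, dotProduct_add, h.dotProduct_eq_zero hk hr,
      dotProduct_comm g r]
    ring
  by_contra hno
  have hno' : ∀ k ∈ V, ∀ r ∈ W, (∀ e, 0 ≤ o e * (g e + k e)) → (∀ e, 0 ≤ o e * (g e + r e)) →
      0 < g ⬝ᵥ g + k ⬝ᵥ g + r ⬝ᵥ g := by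
    intro k hk r hr h1 h2
    rw [← hexp k hk r hr]
    have hnn := hmul (g + k) (g + r) h1 h2
    refine lt_of_le_of_ne (Finset.sum_nonneg fun e _ => hnn e) fun h0 => hno ?_
    refine ⟨g + k, g + r, by simpa using hk, by simpa using hr, h1, h2, fun e => ?_⟩
    exact mul_eq_zero.1 ((Finset.sum_eq_zero_iff_of_nonneg fun e _ => hnn e).1 h0.symm e
      (Finset.mem_univ e))
  -- Homogenization: the coordinate `t` scales `g`, and insolubility says that the constraints imply
  -- `t ≤ 0`. Farkas then gives multipliers `τ`, `a`, `b`.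
  let X := (V × W) × ℝ
  let pV : X →ₗ[ℝ] (E → ℝ) := V.subtype ∘ₗ LinearMap.fst ℝ V W ∘ₗ LinearMap.fst ℝ _ _
  let pW : X →ₗ[ℝ] (E → ℝ) := W.subtype ∘ₗ LinearMap.snd ℝ V W ∘ₗ LinearMap.fst ℝ _ _
  let pt : X →ₗ[ℝ] ℝ := LinearMap.snd ℝ _ _
  let dg : (E → ℝ) →ₗ[ℝ] ℝ := dotProductBilin ℝ ℝ g
  have hdg : ∀ a, dg a = a ⬝ᵥ g := fun a => dotProduct_comm g a
  let L : Option (E ⊕ E) → (X →ₗ[ℝ] ℝ) := fun i => match i with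
    | none => -((g ⬝ᵥ g) • pt + dg ∘ₗ pV + dg ∘ₗ pW)
    | some (Sum.inl e) => o e • (g e • pt + LinearMap.proj e ∘ₗ pV)
    | some (Sum.inr e) => o e • (g e • pt + LinearMap.proj e ∘ₗ pW)
  obtain ⟨c, hc, hb⟩ := farkas Finset.univ L (-pt) (by
    rintro ⟨⟨k, r⟩, t⟩ hx
    have h1 : ∀ e, 0 ≤ o e * (g e * t + k.1 e) := fun e =>
      hx (some (Sum.inl e)) (Finset.mem_univ _)
    have h2 : ∀ e, 0 ≤ o e * (g e * t + r.1 e) := fun e =>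
      hx (some (Sum.inr e)) (Finset.mem_univ _)
    have h3 : 0 ≤ -((g ⬝ᵥ g) * t + dg k.1 + dg r.1) := hx none (Finset.mem_univ _)
    rw [hdg, hdg] at h3
    change 0 ≤ -t
    by_contra ht
    have ht : 0 < t := by linarith
    have h4 := hno' (t⁻¹ • k.1) (V.smul_mem _ k.2) (t⁻¹ • r.1) (W.smul_mem _ r.2)
      (fun e => by
        have : o e * (g e + (t⁻¹ • k.1) e) = t⁻¹ * (o e * (g e * t + k.1 e)) := by
          simp only [Pi.smul_apply, smul_eq_mul]; field_simp
        rw [this]; exact mul_nonneg (inv_nonneg.2 ht.le) (h1 e))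
      (fun e => by
        have : o e * (g e + (t⁻¹ • r.1) e) = t⁻¹ * (o e * (g e * t + r.1 e)) := by
          simp only [Pi.smul_apply, smul_eq_mul]; field_simp
        rw [this]; exact mul_nonneg (inv_nonneg.2 ht.le) (h2 e))
    rw [smul_dotProduct, smul_dotProduct, smul_eq_mul, smul_eq_mul] at h4
    have h5 : g ⬝ᵥ g + t⁻¹ * k.1 ⬝ᵥ g + t⁻¹ * r.1 ⬝ᵥ g
        = t⁻¹ * ((g ⬝ᵥ g) * t + k.1 ⬝ᵥ g + r.1 ⬝ᵥ g) := by field_simp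
    rw [h5] at h4
    have := (pos_iff_pos_of_mul_pos h4).1 (inv_pos.2 ht)
    linarith)
  set τ := c none with hτ
  let a : E → ℝ := fun e => c (some (Sum.inl e)) * o e
  let b : E → ℝ := fun e => c (some (Sum.inr e)) * o e
  have ha : ∀ e, 0 ≤ o e * a e := fun e => by
    have : o e * a e = c (some (Sum.inl e)) * (o e * o e) := by simp only [a]; ring
    rw [this, hoo, mul_one]; exact hc _
  have hb' : ∀ e, 0 ≤ o e * b e := fun e => by
    have : o e * b e = c (some (Sum.inr e)) * (o e * o e) := by simp only [b]; ring
    rw [this, hoo, mul_one]; exact hc _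
  have hid : ∀ (k : V) (r : W) (t : ℝ), -t = -τ * ((g ⬝ᵥ g) * t + k.1 ⬝ᵥ g + r.1 ⬝ᵥ g)
      + ((a ⬝ᵥ g) * t + a ⬝ᵥ k.1) + ((b ⬝ᵥ g) * t + b ⬝ᵥ r.1) := by
    intro k r t
    have h1 := LinearMap.congr_fun hb ((k, r), t)
    rw [LinearMap.sum_apply, Fintype.sum_option, Fintype.sum_sum_type] at h1
    have e1 : (c none • L none) ((k, r), t) = -τ * ((g ⬝ᵥ g) * t + k.1 ⬝ᵥ g + r.1 ⬝ᵥ g) := by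
      rw [← hdg k.1, ← hdg r.1]
      change τ * -((g ⬝ᵥ g) * t + dg k.1 + dg r.1) = _
      ring
    have e2 : ∑ e, (c (some (Sum.inl e)) • L (some (Sum.inl e))) ((k, r), t)
        = (a ⬝ᵥ g) * t + a ⬝ᵥ k.1 := by
      rw [dotProduct, dotProduct, Finset.sum_mul, ← Finset.sum_add_distrib]
      refine Finset.sum_congr rfl fun e _ => ?_
      change c (some (Sum.inl e)) * (o e * (g e * t + k.1 e)) = _
      simp only [a]; ring
    have e3 : ∑ e, (c (some (Sum.inr e)) • L (some (Sum.inr e))) ((k, r), t)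
        = (b ⬝ᵥ g) * t + b ⬝ᵥ r.1 := by
      rw [dotProduct, dotProduct, Finset.sum_mul, ← Finset.sum_add_distrib]
      refine Finset.sum_congr rfl fun e _ => ?_
      change c (some (Sum.inr e)) * (o e * (g e * t + r.1 e)) = _
      simp only [b]; ring
    rw [e1, e2, e3] at h1
    rw [add_assoc]
    exact h1
  have haW : a - τ • g ∈ W := by
    rw [h.mem_right]
    intro v hv
    have := hid ⟨v, hv⟩ 0 0
    simp only [ZeroMemClass.coe_zero, zero_dotProduct, dotProduct_zero, mul_zero, zero_add,
      add_zero, neg_zero] at this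
    rw [sub_dotProduct, smul_dotProduct, smul_eq_mul, dotProduct_comm g v]
    linarith
  have hbV : b - τ • g ∈ V := by
    rw [h.mem_left]
    intro w hw
    have := hid 0 ⟨w, hw⟩ 0
    simp only [ZeroMemClass.coe_zero, zero_dotProduct, dotProduct_zero, mul_zero, zero_add,
      add_zero, neg_zero] at this
    rw [sub_dotProduct, smul_dotProduct, smul_eq_mul, dotProduct_comm g w]
    linarith
  have hone := hid 0 0 1
  simp only [ZeroMemClass.coe_zero, zero_dotProduct, dotProduct_zero, mul_one, add_zero] at hone
  -- If `τ = 0`, then `a ∈ W` and `b ∈ V` have nonnegative weight by `hC` and `hD`, while `hone`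
  -- makes the weights sum to `-1`. If `τ > 0`, orthogonality of `a - τ • g` and `b - τ • g` gives
  -- `b ⬝ᵥ a = -τ < 0`.
  rcases (hc none).eq_or_lt with h0 | hpos
  · have hτ0 : τ = 0 := h0.symm
    rw [hτ0, zero_smul, sub_zero] at haW hbV
    have h1 := h.right.dotProduct_nonneg ho hD a haW ha
    have h2 := h.left.dotProduct_nonneg ho hC b hbV hb'
    rw [hτ0] at hone
    linarith
  · have h1 : 0 ≤ b ⬝ᵥ a := Finset.sum_nonneg fun e _ => hmul b a hb' ha e
    have h2 := h.dotProduct_eq_zero hbV haW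
    rw [sub_dotProduct, dotProduct_sub, dotProduct_sub, smul_dotProduct, smul_dotProduct,
      dotProduct_smul, dotProduct_smul, dotProduct_comm g a] at h2
    simp only [smul_eq_mul] at h2
    have h3 : b ⬝ᵥ a = τ * (-τ * (g ⬝ᵥ g) + a ⬝ᵥ g + b ⬝ᵥ g) + 0 := by linarith
    rw [← hone] at h3
    change 0 < τ at hpos
    linarith

/-- `x` and `y` are complementary solutions, supported on `B` and on the complement of `B`, of the
linear program given by `g` and `o`. -/
def IsOptimalBasis (V W : Submodule ℝ (E → ℝ)) (g o : E → ℝ) (B : Set E) : Prop :=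
  ∃ x y, x - g ∈ V ∧ y - g ∈ W ∧ (∀ e, 0 ≤ o e * x e) ∧ (∀ e, 0 ≤ o e * y e) ∧
    (∀ e, x e ≠ 0 ↔ e ∈ B) ∧ (∀ e, y e ≠ 0 ↔ e ∉ B)

/-- Genericity excludes degeneracy: a signed circuit on the zeros of `y` would have weight `0`, so
these zeros are independent; dually the zeros of `x` are coindependent. Complementarity then
squeezes a basis between the support of `x` and the zeros of `y`. -/
theorem RegularPair.exists_isOptimalBasis [Fintype E] (h : RegularPair N V W) {o g : E → ℝ}
    (hg : ∀ v : E → ℝ, IsSignVector v → v ≠ 0 → v ⬝ᵥ g ≠ 0) (ho : IsOrient o)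
    (hC : ∀ c, SignedCircuitIn N V c → (∀ e, c e ≠ 0 → c e = o e) → 0 ≤ c ⬝ᵥ g)
    (hD : ∀ c, SignedCircuitIn N✶ W c → (∀ e, c e ≠ 0 → c e = o e) → 0 ≤ c ⬝ᵥ g) :
    ∃ B, N.IsBase B ∧ IsOptimalBasis V W g o B := by
  obtain ⟨x, y, hx, hy, hox, hoy, hxy⟩ := h.exists_optimal ho hC hD
  have key : ∀ {N' : Matroid E} {V' W' : Submodule ℝ (E → ℝ)} (h' : RegularPair N' V' W')
      (z : E → ℝ), z - g ∈ W' → N'.Indep (Function.support z)ᶜ := by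
    intro N' V' W' h' z hz
    rw [h'.left.indep_iff]
    intro v hv hvz
    by_contra h0
    obtain ⟨c, hc, hcv⟩ := h'.left.exists_conformal hv h0
    have h1 := h'.dotProduct_eq_zero hc.mem hz
    have h2 : c ⬝ᵥ z = 0 := Finset.sum_eq_zero fun e _ => by
      by_cases hce : c e = 0
      · simp [hce]
      have hve : v e ≠ 0 := by
        intro hve
        have := hcv e hce
        simp [hve] at this
      have : z e = 0 := by simpa using hvz hve
      simp [this]
    rw [dotProduct_sub, h2] at h1
    exact hg c hc.sign hc.ne_zero (by linarith)
  have hiy := key h y hy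
  have hix := key h.dual x hx
  rw [Matroid.dual_indep_iff_exists'] at hix
  obtain ⟨-, B, hB, hd⟩ := hix
  have hBx : B ⊆ Function.support x := fun e he => by
    by_contra hex
    exact hd.le_bot ⟨hex, he⟩
  have hxy' : Function.support x ⊆ (Function.support y)ᶜ := fun e he hey =>
    (hxy e).elim he hey
  have hBy := hB.eq_of_subset_indep hiy (hBx.trans hxy')
  refine ⟨B, hB, x, y, hx, hy, hox, hoy, fun e => ⟨fun he => ?_, fun he => hBx he⟩, fun e => ?_⟩
  · rw [hBy]; exact hxy' he
  · rw [hBy]; simp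

/-- The basis alone fixes `x` and `y`, since `V` has no nonzero vector on `B` and `W` none off `B`;
their signs together give the whole orientation. -/
theorem IsOptimalBasis.unique [Fintype E] (h : RegularPair N V W) {o o' g : E → ℝ}
    {B : Set E} (hB : N.IsBase B) (ho : IsOrient o) (ho' : IsOrient o')
    (h1 : IsOptimalBasis V W g o B) (h2 : IsOptimalBasis V W g o' B) : o = o' := by
  obtain ⟨x, y, hx, hy, hox, hoy, hxB, hyB⟩ := h1
  obtain ⟨x', y', hx', hy', hox', hoy', hxB', hyB'⟩ := h2
  have ex : x - x' = 0 := by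
    refine (h.left.indep_iff B).1 hB.indep _ ?_ fun e he => ?_
    · have := V.sub_mem hx hx'
      simpa using this
    · by_contra heB
      have e1 : x e = 0 := by simpa [heB] using hxB e
      have e2 : x' e = 0 := by simpa [heB] using hxB' e
      exact he (by simp [e1, e2])
  have ey : y - y' = 0 := by
    have hBd : N✶.Indep Bᶜ := by
      rw [Matroid.dual_indep_iff_exists']
      exact ⟨by simp [h.left.ground], B, hB, disjoint_compl_left⟩
    refine (h.right.indep_iff _).1 hBd _ ?_ fun e he heB => ?_
    · have := W.sub_mem hy hy'
      simpa using this
    · have e1 : y e = 0 := by simpa [heB] using hyB e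
      have e2 : y' e = 0 := by simpa [heB] using hyB' e
      exact he (by simp [e1, e2])
  obtain rfl := sub_eq_zero.1 ex
  obtain rfl := sub_eq_zero.1 ey
  have key : ∀ e, ∀ z : ℝ, z ≠ 0 → 0 ≤ o e * z → 0 ≤ o' e * z → o e = o' e := by
    intro e z hz h1 h2
    rcases ho e with h | h <;> rcases ho' e with h' | h' <;> rw [h] at h1 ⊢ <;> rw [h'] at h2 ⊢ <;>
      exact absurd (by linarith) hz
  ext e
  by_cases he : e ∈ B
  · exact key e _ ((hxB e).2 he) (hox e) (hox' e)
  · exact key e _ ((hyB e).2 he) (hoy e) (hoy' e)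

theorem finite_isOrient [Fintype E] : {o : E → ℝ | IsOrient o}.Finite :=
  finite_isSignVector.subset fun _ ho e => Or.inr (ho e)

/-- There are at most as many circuit-cocircuit reversal classes as bases. -/
theorem RegularPair.exists_base_invariant [Fintype E] (h : RegularPair N V W) :
    ∃ β : (E → ℝ) → Base N, ∀ o o', IsOrient o → IsOrient o' → β o = β o' →
      Relation.EqvGen (Step N V W) o o' := by
  classical
  obtain ⟨g, hg⟩ := exists_generic (E := E)
  have key : ∀ o, ∃ B : Base N, IsOrient o → ∃ o₁, Relation.EqvGen (Step N V W) o o₁ ∧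
      IsOptimalBasis V W g o₁ B.1 := by
    intro o
    by_cases ho : IsOrient o
    swap
    · obtain ⟨B, hB⟩ := N.exists_isBase
      exact ⟨⟨B, hB⟩, fun h => absurd h ho⟩
    obtain ⟨o₁, hoo₁, hmax⟩ := Set.exists_max_image
      {o' | Relation.EqvGen (Step N V W) o o'} (fun o' => o' ⬝ᵥ g)
      (finite_isOrient.subset fun o' ho' => (eqvGen_isOrient_iff ho').1 ho)
      ⟨o, Relation.EqvGen.refl o⟩
    -- Reversing `c` changes the weight by `-2 * (c ⬝ᵥ g)`, so maximality is exactly the hypothesis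
    -- of the duality argument.
    have hstep : ∀ c : E → ℝ, Step N V W o₁ (o₁ - (2 : ℝ) • c) → 0 ≤ c ⬝ᵥ g := by
      intro c hc
      have := hmax (o₁ - (2 : ℝ) • c) (Relation.EqvGen.trans _ _ _ hoo₁ (Relation.EqvGen.rel _ _ hc))
      rw [sub_dotProduct, smul_dotProduct, smul_eq_mul] at this
      linarith
    obtain ⟨B, hB, hopt⟩ := h.exists_isOptimalBasis hg ((eqvGen_isOrient_iff hoo₁).1 ho)
      (fun c hc hco => hstep c (Or.inl ⟨c, hc, hco, rfl⟩))
      (fun c hc hco => hstep c (Or.inr ⟨c, hc, hco, rfl⟩))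
    exact ⟨⟨B, hB⟩, fun _ => ⟨o₁, hoo₁, hopt⟩⟩
  choose β hβ using key
  refine ⟨β, fun o o' ho ho' hoo' => ?_⟩
  obtain ⟨o₁, h1, h2⟩ := hβ o ho
  obtain ⟨o₂, h3, h4⟩ := hβ o' ho'
  rw [← hoo'] at h4
  obtain rfl := IsOptimalBasis.unique h (β o).2 ((eqvGen_isOrient_iff h1).1 ho)
    ((eqvGen_isOrient_iff h3).1 ho') h2 h4
  exact Relation.EqvGen.trans _ _ _ h1 (Relation.EqvGen.symm _ _ h3)

end RegularMatroid

/-! ### Separation by orthogonality -/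

namespace RegularMatroid

variable {E : Type*} {N : Matroid E} {V W : Submodule ℝ (E → ℝ)}

theorem RegularPair.exists_pos_mem_right [Fintype E] (h : RegularPair N V W) (s : E → ℝ)
    {P Z : Set E} (hPZ : Disjoint P Z) (hs : ∀ e ∈ P, s e ≠ 0)
    (hV : ∀ v ∈ V, (∀ f ∈ Z, v f = 0) → (∀ f ∈ P, 0 ≤ s f * v f) → v = 0) :
    ∃ w ∈ W, (∀ e ∈ P, 0 < s e * w e) ∧ (∀ e, e ∉ P → e ∉ Z → w e = 0) ∧ ∀ e, |w e| ≤ 1 := by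
  classical
  have key : ∀ e, ∃ w ∈ W, (∀ f ∈ P, 0 ≤ s f * w f) ∧ (∀ f, f ∉ P → f ∉ Z → w f = 0) ∧
      (e ∈ P → 0 < s e * w e) := by
    intro e
    by_cases he : e ∈ P
    · obtain ⟨w, hw, h1, h2, h3⟩ := h.exists_mem_right s hPZ he (hs e he)
        (fun v hv hZ hP => by simp [hV v hv hZ hP])
      exact ⟨w, hw, h1, h2, fun _ => h3⟩
    · exact ⟨0, W.zero_mem, by simp, by simp, fun h => absurd h he⟩
  choose w hw h1 h2 h3 using key
  set u := ∑ f, w f with hu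
  have hue : ∀ e, u e = ∑ f, w f e := fun e => by rw [hu, Finset.sum_apply]
  set T := 1 + ∑ e, |u e| with hT
  have hTpos : 0 < T := by positivity
  refine ⟨T⁻¹ • u, W.smul_mem _ (W.sum_mem fun f _ => hw f), fun e he => ?_, fun e he he' => ?_,
    fun e => ?_⟩
  · have : 0 < s e * u e := by
      rw [hue, Finset.mul_sum]
      exact Finset.sum_pos' (fun f _ => h1 f e he) ⟨e, Finset.mem_univ e, h3 e he⟩
    rw [Pi.smul_apply, smul_eq_mul, mul_left_comm]
    exact mul_pos (inv_pos.2 hTpos) this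
  · rw [Pi.smul_apply, hue, Finset.sum_eq_zero fun f _ => h2 f e he he', smul_zero]
  · rw [Pi.smul_apply, smul_eq_mul, abs_mul, abs_of_pos (inv_pos.2 hTpos), inv_mul_le_iff₀ hTpos]
    have := Finset.single_le_sum (f := fun e => |u e|) (fun e _ => abs_nonneg (u e))
      (Finset.mem_univ e)
    linarith

/-- `hT` is triangulation: no signed circuit fits in the fourientation built from the two bases. It
says that the sign pattern `s` admits no nonzero vector of `V`, and Farkas then produces a vector of
`W` positive on the pattern. The entries of `w` are unconstrained on `Z`. -/
theorem RegularPair.exists_separating [Fintype E] (h : RegularPair N V W) {B₁ B₂ : Set E}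
    {f₁ f₂ : E → ℝ} (hf₁ : IsOrient f₁) (hf₂ : IsOrient f₂)
    (hT : ∀ v, SignedCircuitIn N V v →
      ∃ e, v e ≠ 0 ∧ ((e ∉ B₁ ∧ f₁ e = -v e) ∨ (e ∉ B₂ ∧ f₂ e = v e))) :
    ∃ w ∈ W, (∀ e, |w e| ≤ 1) ∧ (∀ e, e ∈ B₁ → e ∈ B₂ → w e = 0) ∧
      (∀ e, e ∈ B₁ → e ∉ B₂ → 0 < -f₂ e * w e) ∧ (∀ e, e ∉ B₁ → e ∈ B₂ → 0 < f₁ e * w e) ∧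
      (∀ e, e ∉ B₁ → e ∉ B₂ → f₁ e ≠ f₂ e → 0 < f₁ e * w e) := by
  classical
  let Z : Set E := {e | e ∉ B₁ ∧ e ∉ B₂ ∧ f₁ e = f₂ e}
  let P : Set E := {e | ¬ (e ∈ B₁ ∧ e ∈ B₂) ∧ e ∉ Z}
  let s : E → ℝ := fun e => if e ∈ B₁ then -f₂ e else f₁ e
  obtain ⟨w, hw, h1, h2, h3⟩ := h.exists_pos_mem_right s (P := P) (Z := Z)
    (Set.disjoint_left.2 fun e he => he.2)
    (fun e _ => by
      simp only [s]
      split_ifs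
      · exact neg_ne_zero.2 (hf₂.ne_zero e)
      · exact hf₁.ne_zero e)
    (fun v hv hZ hP => by
      by_contra h0
      obtain ⟨c, hc, hcv⟩ := h.left.exists_conformal hv h0
      obtain ⟨e, hce, he⟩ := hT c hc
      have hpos := hcv e hce
      have heZ : e ∉ Z := fun heZ => by
        rw [hZ e heZ, mul_zero] at hpos
        exact lt_irrefl _ hpos
      have heP : e ∈ P := ⟨fun hb => he.elim (fun h => h.1 hb.1) (fun h => h.1 hb.2), heZ⟩
      have hse : s e = -c e := by
        simp only [s]
        split_ifs with hb
        · rcases he with he | he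
          · exact absurd hb he.1
          · rw [he.2]
        · rcases he with he | he
          · exact he.2
          · have : f₁ e ≠ f₂ e := fun hff => heZ ⟨hb, he.1, hff⟩
            rw [← he.2]
            rcases hf₁ e with h | h <;> rcases hf₂ e with h' | h' <;> rw [h, h'] at this ⊢ <;>
              simp at this
            norm_num
      have := hP e heP
      rw [hse] at this
      linarith)
  refine ⟨w, hw, h3, fun e he he' => h2 e (fun h => h.1 ⟨he, he'⟩) fun h => h.1 he,
    fun e he he' => ?_, fun e he he' => ?_, fun e he he' hf => ?_⟩
  · simpa [s, he] using h1 e ⟨fun h => he' h.2, fun h => h.1 he⟩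
  · simpa [s, he] using h1 e ⟨fun h => he h.1, fun h => h.2.1 he'⟩
  · simpa [s, he] using h1 e ⟨fun h => he h.1, fun h => hf h.2.2⟩

/-- The situation on a single edge, checked case by case. The halves of `C` and `δ` are at most
`1/2` in absolute value, so they decide the sign of a factor only where the integer part vanishes.
-/
theorem sign_product {f₁ f₂ c₁ c₂ d₁ d₂ C δ : ℝ} {b₁ b₂ : Prop} (hf₁ : f₁ = 1 ∨ f₁ = -1)
    (hf₂ : f₂ = 1 ∨ f₂ = -1) (hs₁ : c₁ = 0 ∧ d₁ = 0 ∨ c₁ = f₁ ∧ d₁ = 0 ∨ c₁ = 0 ∧ d₁ = f₁)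
    (hs₂ : c₂ = 0 ∧ d₂ = 0 ∨ c₂ = f₂ ∧ d₂ = 0 ∨ c₂ = 0 ∧ d₂ = f₂)
    (hno : f₁ - 2 * c₁ - 2 * d₁ = f₂ - 2 * c₂ - 2 * d₂ ∨
      ((b₁ ∨ c₁ ≠ 0) ∧ d₁ = 0 ↔ (b₂ ∨ c₂ ≠ 0) ∧ d₂ = 0))
    (hC₀ : C = 0 ∨ C = 1 ∨ C = -1) (hC : C ≠ 0 → b₁ ∧ f₁ = -C ∨ b₂ ∧ f₂ = C)
    (hδ₁ : δ ≤ 1) (hδ₂ : -1 ≤ δ) (h11 : b₁ → b₂ → δ = 0) (h10 : b₁ → ¬ b₂ → 0 < -f₂ * δ)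
    (h01 : ¬ b₁ → b₂ → 0 < f₁ * δ) (h00 : ¬ b₁ → ¬ b₂ → f₁ ≠ f₂ → 0 < f₁ * δ) :
    0 ≤ (C / 2 + (c₁ - c₂)) * (δ / 2 + (d₂ - d₁)) ∧
      ((C / 2 + (c₁ - c₂)) * (δ / 2 + (d₂ - d₁)) = 0 → C ≠ 0 → b₁ ∧ b₂) := by
  by_cases hb₁ : b₁ <;> by_cases hb₂ : b₂ <;> rcases hf₁ with rfl | rfl <;>
    rcases hf₂ with rfl | rfl <;> simp [hb₁, hb₂] at h11 h10 h01 h00 hC hno ⊢ <;>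
    (try norm_num at h00) <;>
    rcases hC₀ with rfl | rfl | rfl <;> (try norm_num at hC) <;>
    rcases hs₁ with ⟨rfl, rfl⟩ | ⟨rfl, rfl⟩ | ⟨rfl, rfl⟩ <;>
    rcases hs₂ with ⟨rfl, rfl⟩ | ⟨rfl, rfl⟩ | ⟨rfl, rfl⟩ <;>
    (try norm_num at hno) <;>
    (try subst h11) <;>
    first
    | (norm_num; done)
    | (refine ⟨by linarith, fun h => ?_⟩; norm_num; done)
    | (refine ⟨by linarith, fun h => ?_⟩; exfalso; norm_num at h; rcases h with h | h <;> linarith)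
    | (refine ⟨by linarith, fun h => ?_⟩; exfalso; norm_num at h; linarith)

theorem Reversible.cases {f c d : E → ℝ} (h : Reversible V W f c d) (e : E) :
    c e = 0 ∧ d e = 0 ∨ c e = f e ∧ d e = 0 ∨ c e = 0 ∧ d e = f e := by
  by_cases hc : c e = 0
  · by_cases hd : d e = 0
    · exact Or.inl ⟨hc, hd⟩
    · exact Or.inr (Or.inr ⟨hc, h.conf_right e hd⟩)
  · exact Or.inr (Or.inl ⟨h.conf_left e hc, (h.disj e).resolve_left hc⟩)

/-- The subset of edges assigned to a basis `B` and to the reversal of `c` and `d`. -/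
def tileSet (B : Set E) (c d : E → ℝ) : Set E :=
  (B ∪ Function.support c) \ Function.support d

theorem mem_tileSet {B : Set E} {c d : E → ℝ} {e : E} :
    e ∈ tileSet B c d ↔ (e ∈ B ∨ c e ≠ 0) ∧ d e = 0 := by
  simp [tileSet]

/-- Since `c` and `d` have disjoint supports, the order of adding and deleting edges is irrelevant.
-/
theorem Reversible.tileSet_dual {B : Set E} {f c d : E → ℝ} (h : Reversible V W f c d) :
    tileSet Bᶜ d c = (tileSet B c d)ᶜ := by
  ext e
  have := h.disj e
  simp only [mem_tileSet, Set.mem_compl_iff]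
  tauto

theorem RegularPair.not_tile [Fintype E] (h : RegularPair N V W) {B₁ B₂ : Set E}
    (hB₁ : N.Indep B₁) {f₁ f₂ c₁ c₂ d₁ d₂ C : E → ℝ} (hf₁ : IsOrient f₁) (hf₂ : IsOrient f₂)
    (h₁ : Reversible V W f₁ c₁ d₁) (h₂ : Reversible V W f₂ c₂ d₂)
    (hC : SignedCircuitIn N V C)
    (hCB : ∀ e, C e ≠ 0 → e ∈ B₁ ∧ f₁ e = -C e ∨ e ∈ B₂ ∧ f₂ e = C e)
    (hT : ∀ v, SignedCircuitIn N V v →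
      ∃ e, v e ≠ 0 ∧ ((e ∉ B₁ ∧ f₁ e = -v e) ∨ (e ∉ B₂ ∧ f₂ e = v e)))
    (hno : ∀ e, f₁ e - 2 * c₁ e - 2 * d₁ e = f₂ e - 2 * c₂ e - 2 * d₂ e ∨
      (e ∈ tileSet B₁ c₁ d₁ ↔ e ∈ tileSet B₂ c₂ d₂)) : False := by
  obtain ⟨w, hw, hw1, h11, h10, h01, h00⟩ := h.exists_separating hf₁ hf₂ hT
  have key := fun e => sign_product (b₁ := e ∈ B₁) (b₂ := e ∈ B₂) (hf₁ e) (hf₂ e)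
    (h₁.cases e) (h₂.cases e) (by simpa only [mem_tileSet] using hno e) (hC.sign e) (hCB e)
    (abs_le.1 (hw1 e)).2 (abs_le.1 (hw1 e)).1 (h11 e) (h10 e) (h01 e) (h00 e)
  have hv : (2⁻¹ : ℝ) • C + (c₁ - c₂) ∈ V :=
    V.add_mem (V.smul_mem _ hC.mem) (V.sub_mem h₁.mem_left h₂.mem_left)
  have hw' : (2⁻¹ : ℝ) • w + (d₂ - d₁) ∈ W :=
    W.add_mem (W.smul_mem _ hw) (W.sub_mem h₂.mem_right h₁.mem_right)
  have heq : ∀ e, ((2⁻¹ : ℝ) • C + (c₁ - c₂)) e * ((2⁻¹ : ℝ) • w + (d₂ - d₁)) e =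
      (C e / 2 + (c₁ e - c₂ e)) * (w e / 2 + (d₂ e - d₁ e)) := fun e => by
    simp only [Pi.add_apply, Pi.smul_apply, Pi.sub_apply, smul_eq_mul]; ring
  have h0 := h.dotProduct_eq_zero hv hw'
  rw [dotProduct, Finset.sum_eq_zero_iff_of_nonneg fun e _ => heq e ▸ (key e).1] at h0
  refine h.left.not_indep hC.mem hC.ne_zero (I := B₁) (fun e he => ?_) hB₁
  exact ((key e).2 (heq e ▸ h0 e (Finset.mem_univ e)) he).1

/-- The differences of the `c`'s and of the `d`'s are orthogonal with nonnegative products. When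
these vanish, the first difference is supported in `B` and the second off `B`, so both are zero. -/
theorem RegularPair.eq_of_tile [Fintype E] (h : RegularPair N V W) {B : Set E}
    (hB : N.IsBase B) {f c₁ c₂ d₁ d₂ : E → ℝ} (hf : IsOrient f)
    (h₁ : Reversible V W f c₁ d₁) (h₂ : Reversible V W f c₂ d₂)
    (hno : ∀ e, f e - 2 * c₁ e - 2 * d₁ e = f e - 2 * c₂ e - 2 * d₂ e ∨
      (e ∈ tileSet B c₁ d₁ ↔ e ∈ tileSet B c₂ d₂)) : c₁ = c₂ ∧ d₁ = d₂ := by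
  have hv := V.sub_mem h₁.mem_left h₂.mem_left
  have hw := W.sub_mem h₂.mem_right h₁.mem_right
  have key : ∀ e, 0 ≤ (c₁ e - c₂ e) * (d₂ e - d₁ e) ∧
      ((c₁ e - c₂ e) * (d₂ e - d₁ e) = 0 → (e ∉ B → c₁ e = c₂ e) ∧ (e ∈ B → d₂ e = d₁ e)) := by
    intro e
    have hno' := hno e
    rw [mem_tileSet, mem_tileSet] at hno'
    by_cases hb : e ∈ B <;> rcases hf e with hfe | hfe <;>
      rcases h₁.cases e with ⟨hc, hd⟩ | ⟨hc, hd⟩ | ⟨hc, hd⟩ <;>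
      rcases h₂.cases e with ⟨hc', hd'⟩ | ⟨hc', hd'⟩ | ⟨hc', hd'⟩ <;>
      simp only [hb, hfe, hc, hc', hd, hd'] at hno' ⊢ <;>
      first | (norm_num at hno'; done) | norm_num
  have h0 : ∑ e, (c₁ e - c₂ e) * (d₂ e - d₁ e) = 0 := h.dotProduct_eq_zero hv hw
  rw [Finset.sum_eq_zero_iff_of_nonneg fun e _ => (key e).1] at h0
  have h0' := fun e => (key e).2 (h0 e (Finset.mem_univ e))
  constructor
  · refine sub_eq_zero.1 ((h.left.indep_iff B).1 hB.indep _ hv fun e he => ?_)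
    by_contra hb
    exact he (by simp [(h0' e).1 hb])
  · have hBd : N✶.Indep Bᶜ := by
      rw [Matroid.dual_indep_iff_exists']
      exact ⟨by simp [h.left.ground], B, hB, disjoint_compl_left⟩
    refine (sub_eq_zero.1 ((h.right.indep_iff _).1 hBd _ hw fun e he hb => ?_)).symm
    exact he (by simp [(h0' e).2 hb])

end RegularMatroid

/-! ### Class representatives; independent and spanning images -/

namespace RegularMatroid

section Abstract

variable {E : Type*} {N : Matroid E} {V W : Submodule ℝ (E → ℝ)}

theorem RegularPair.eq_zero_of_mem [Fintype E] (h : RegularPair N V W) {v : E → ℝ} (hv : v ∈ V)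
    (hw : v ∈ W) : v = 0 :=
  dotProduct_self_eq_zero.1 (h.dotProduct_eq_zero hv hw)

/-- The orientation `o` arises from `f` by reversing `c` and `d`. -/
def ReversesTo (V W : Submodule ℝ (E → ℝ)) (f c d o : E → ℝ) : Prop :=
  Reversible V W f c d ∧ o = f - (2 : ℝ) • c - (2 : ℝ) • d

theorem ReversesTo.dual {f c d o : E → ℝ} (h : ReversesTo V W f c d o) : ReversesTo W V f d c o :=
  ⟨h.1.dual, by rw [h.2]; module⟩

theorem Reversible.isSignVector_left {f c d : E → ℝ} (h : Reversible V W f c d)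
    (hf : IsOrient f) : IsSignVector c := fun e => by
  by_cases hc : c e = 0
  · exact Or.inl hc
  · rw [h.conf_left e hc]; exact Or.inr (hf e)

theorem step_dual_iff {o o' : E → ℝ} : Step N✶ W V o o' ↔ Step N V W o o' := by
  rw [Step, Step, Matroid.dual_dual, or_comm]

theorem eqvGen_circuitStep_le {o o' : E → ℝ} (h : Relation.EqvGen (CircuitStep N V) o o') :
    Relation.EqvGen (Step N V W) o o' :=
  Relation.EqvGen.mono (fun _ _ => Or.inl) _ _ h

theorem eqvGen_circuitStep_sub_mem {o o' : E → ℝ} (h : Relation.EqvGen (CircuitStep N V) o o') :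
    o - o' ∈ V := by
  induction h with
  | rel _ _ h => exact h.sub_mem
  | refl => simp
  | symm _ _ _ ih => simpa using V.neg_mem ih
  | trans _ _ _ _ _ ih ih' => simpa using V.add_mem ih ih'

theorem ReversesTo.eqvGen_left [Fintype E] (h : RegularPair N V W) {f c d o : E → ℝ}
    (hf : IsOrient f) (hr : ReversesTo V W f c d o) :
    Relation.EqvGen (CircuitStep N V) (f - (2 : ℝ) • d) o := by
  obtain ⟨hr, rfl⟩ := hr
  have := (h.left.exists_decomposition c hr.mem_left (hr.isSignVector_left hf) (f - (2 : ℝ) • d)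
    fun e he => by simp [(hr.disj e).resolve_left he, hr.conf_left e he]).2
  rwa [sub_right_comm] at this

theorem ReversesTo.eqvGen [Fintype E] (h : RegularPair N V W) {f c d o : E → ℝ}
    (hf : IsOrient f) (hr : ReversesTo V W f c d o) :
    Relation.EqvGen (Step N V W) f o := by
  have h1 : ReversesTo W V f d 0 (f - (2 : ℝ) • d) :=
    ⟨⟨hr.1.mem_right, V.zero_mem, hr.1.conf_right, by simp, by simp⟩, by simp⟩
  have h2 := h1.eqvGen_left h.dual hf
  rw [smul_zero, sub_zero] at h2
  exact Relation.EqvGen.trans _ _ _ (Relation.EqvGen.mono (fun _ _ => Or.inr) _ _ h2)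
    (eqvGen_circuitStep_le (hr.eqvGen_left h hf))

/-- Undoing `c` while keeping `d` stays in the circuit class. Two candidates come from the same
index, so they differ by a vector of `W`, and by one of `V` as they share a circuit class; but `V ∩
W = 0`. -/
theorem RegularPair.existsUnique_representative [Fintype E] (h : RegularPair N V W) {ι : Type*}
    {F : ι → E → ℝ} (hF : ∀ i, IsOrient (F i))
    (hex : ∀ o, IsOrient o → ∃ i c d, ReversesTo V W (F i) c d o)
    (huniq : ∀ i j, Relation.EqvGen (Step N V W) (F i) (F j) → i = j) {o : E → ℝ}
    (ho : IsOrient o) :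
    ∃! o', (∃ i d, ReversesTo V W (F i) 0 d o') ∧ Relation.EqvGen (CircuitStep N V) o o' := by
  obtain ⟨i, c, d, hr⟩ := hex o ho
  have h1 := hr.eqvGen_left h (hF i)
  refine ⟨F i - (2 : ℝ) • d, ⟨⟨i, d, ⟨V.zero_mem, hr.1.mem_right, by simp, hr.1.conf_right,
    by simp⟩, by simp⟩, Relation.EqvGen.symm _ _ h1⟩, ?_⟩
  rintro o' ⟨⟨j, d', hr'⟩, ho'⟩
  obtain rfl : i = j := huniq i j <| Relation.EqvGen.trans _ _ _ (hr.eqvGen h (hF i)) <|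
    Relation.EqvGen.trans _ _ _ (eqvGen_circuitStep_le ho') <|
    Relation.EqvGen.symm _ _ (hr'.eqvGen h (hF j))
  have h2 := eqvGen_circuitStep_sub_mem (Relation.EqvGen.trans _ _ _ h1 ho')
  have h3 := hr'.2
  rw [smul_zero, sub_zero] at h3
  have h4 : F i - (2 : ℝ) • d - o' ∈ W := by
    rw [h3, sub_sub_sub_cancel_left]
    exact W.sub_mem (W.smul_mem _ hr'.1.mem_right) (W.smul_mem _ hr.1.mem_right)
  exact (sub_eq_zero.1 (h.eq_zero_of_mem h2 h4)).symm

/-- The tile contains the support of `c`, which is dependent unless `c = 0`; in that case the tile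
lies inside `B`. -/
theorem Reversible.indep_tileSet_iff [Fintype E] (h : RegularPair N V W) {B : Set E}
    (hB : N.Indep B) {f c d : E → ℝ} (hr : Reversible V W f c d) :
    N.Indep (tileSet B c d) ↔ c = 0 := by
  constructor
  · intro hi
    refine (h.left.indep_iff _).1 hi c hr.mem_left fun e he => ?_
    exact mem_tileSet.2 ⟨Or.inr he, (hr.disj e).resolve_left he⟩
  · rintro rfl
    refine hB.subset fun e he => ?_
    simpa using (mem_tileSet.1 he).1

theorem RegularPair.dual_indep_compl [Fintype E] (h : RegularPair N V W) {B : Set E}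
    (hB : N.IsBase B) : N✶.Indep Bᶜ := by
  have := hB.compl_isBase_dual.indep
  rwa [h.left.ground, ← Set.compl_eq_univ_sdiff] at this

theorem Reversible.spanning_tileSet_iff [Fintype E] (h : RegularPair N V W) {B : Set E}
    (hB : N.IsBase B) {f c d : E → ℝ} (hr : Reversible V W f c d) :
    N.Spanning (tileSet B c d) ↔ d = 0 := by
  rw [← hr.dual.indep_tileSet_iff h.dual (h.dual_indep_compl hB), hr.tileSet_dual,
    Matroid.spanning_iff_compl_coindep (by simp [h.left.ground]), Matroid.coindep_def,
    h.left.ground, ← Set.compl_eq_univ_sdiff]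

/-- A set of pairwise disjoint vectors of `V` contained in `o` has a sum contained in `o`. -/
theorem exists_sum_of_pairwiseDisjoint [Fintype E] {o : E → ℝ} (ho : IsOrient o)
    {𝒞 : Set (E → ℝ)} (h𝒞 : ∀ v ∈ 𝒞, v ∈ V ∧ ∀ e, v e ≠ 0 → v e = o e)
    (hd : 𝒞.PairwiseDisjoint Function.support) :
    ∃ c ∈ V, (∀ e, c e ≠ 0 → c e = o e) ∧ ∀ e, c e ≠ 0 ↔ ∃ v ∈ 𝒞, v e ≠ 0 := by
  classical
  have hfin : 𝒞.Finite := finite_isSignVector.subset fun v hv e => by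
    by_cases hve : v e = 0
    · exact Or.inl hve
    · rw [(h𝒞 v hv).2 e hve]; exact Or.inr (ho e)
  have hval : ∀ v ∈ 𝒞, ∀ e, v e ≠ 0 → (∑ u ∈ hfin.toFinset, u) e = v e := by
    intro v hv e he
    rw [Finset.sum_apply]
    refine Finset.sum_eq_single v (fun u hu huv => ?_) (by simp [hv])
    by_contra hue
    exact (Set.disjoint_left.1 (hd (by simpa using hu) hv huv)) hue he
  have hiff : ∀ e, (∑ u ∈ hfin.toFinset, u) e ≠ 0 ↔ ∃ v ∈ 𝒞, v e ≠ 0 := by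
    refine fun e => ⟨fun he => ?_, fun ⟨v, hv, he⟩ => by rwa [hval v hv e he]⟩
    by_contra hno
    push Not at hno
    exact he (by rw [Finset.sum_apply]; exact Finset.sum_eq_zero fun v hv => hno v (by simpa using hv))
  refine ⟨_, V.sum_mem fun v hv => (h𝒞 v (by simpa using hv)).1, fun e he => ?_, hiff⟩
  obtain ⟨v, hv, hve⟩ := (hiff e).1 he
  rw [hval v hv e hve, (h𝒞 v hv).2 e hve]

end Abstract

/-! ### Orientations as ±1-vectors -/

section Orientations

variable {E : Type*}

/-- The `±1`-vector of an orientation. -/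
noncomputable def val (O : Orientation E) (e : E) : ℝ :=
  (((O.2 e).exists.choose : ℤˣ) : ℤ)

theorem unit_cast_inj {s t : ℤˣ} : (((s : ℤ) : ℝ) = ((t : ℤ) : ℝ)) ↔ s = t := by
  rw [Int.cast_inj, Units.val_inj]

theorem mem_iff_val (O : Orientation E) (e : E) (s : ℤˣ) :
    (e, s) ∈ O.1 ↔ ((s : ℤ) : ℝ) = val O e := by
  have h1 := (O.2 e).exists.choose_spec
  rw [val, unit_cast_inj]
  exact ⟨fun h => (O.2 e).unique h h1, fun h => h ▸ h1⟩

theorem exists_unit {x : ℝ} (hx : x = 1 ∨ x = -1) : ∃ s : ℤˣ, ((s : ℤ) : ℝ) = x := by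
  rcases hx with rfl | rfl
  · exact ⟨1, by simp⟩
  · exact ⟨-1, by simp⟩

theorem isOrient_val (O : Orientation E) : IsOrient (val O) := fun e => by
  rw [val]
  rcases Int.units_eq_one_or (O.2 e).exists.choose with h | h <;> simp [h]

theorem eq_setOf_iff (O : Orientation E) {o : E → ℝ} {X : Fourientation E}
    (hX : ∀ e (s : ℤˣ), (e, s) ∈ X ↔ ((s : ℤ) : ℝ) = o e) : O.1 = X ↔ val O = o := by
  constructor
  · intro h
    ext e
    obtain ⟨s, hs⟩ := exists_unit (isOrient_val O e)
    rw [← hs, ← hX, ← h, mem_iff_val]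
    exact hs
  · intro h
    ext ⟨e, s⟩
    rw [hX, mem_iff_val, h]

theorem val_injective : Function.Injective (val : Orientation E → E → ℝ) := fun O O' h =>
  Subtype.ext ((eq_setOf_iff O (mem_iff_val O')).2 h)

theorem exists_val_eq {o : E → ℝ} (ho : IsOrient o) : ∃ O : Orientation E, val O = o := by
  let O : Orientation E := ⟨{a | ((a.2 : ℤ) : ℝ) = o a.1}, fun e => by
    obtain ⟨s, hs⟩ := exists_unit (ho e)
    exact ⟨s, hs, fun t ht => unit_cast_inj.1 (Eq.trans ht hs.symm)⟩⟩
  exact ⟨O, (eq_setOf_iff O fun e s => Iff.rfl).1 rfl⟩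

theorem restrict_eq_iff (O O' : Orientation E) (e : E) :
    restrict O.1 e = restrict O'.1 e ↔ val O e = val O' e := by
  constructor
  · intro h
    obtain ⟨s, hs⟩ := exists_unit (isOrient_val O e)
    have h1 : (e, s) ∈ restrict O.1 e := ⟨(mem_iff_val O e s).2 hs, rfl⟩
    rw [h] at h1
    rw [← hs]
    exact (mem_iff_val O' e s).1 h1.1
  · intro h
    ext ⟨f, s⟩
    simp only [restrict, Set.mem_ofPred_eq, mem_iff_val]
    constructor <;> rintro ⟨h1, rfl⟩ <;> simp [h1, h]

theorem arcs_subset_iff {v : E → ℝ} (hv : IsSignVector v) (O : Orientation E) :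
    arcs v ⊆ O.1 ↔ ∀ e, v e ≠ 0 → v e = val O e := by
  constructor
  · intro h e he
    obtain ⟨s, hs⟩ := exists_unit ((hv e).resolve_left he)
    rw [← hs]
    exact (mem_iff_val O e s).1 (h hs.symm)
  · rintro h ⟨e, s⟩ (hs : v e = ((s : ℤ) : ℝ))
    rw [mem_iff_val, ← hs]
    refine h e ?_
    rw [hs]
    rcases Int.units_eq_one_or s with rfl | rfl <;> simp

/-- Reversing a family contained in `O` depends only on the union of its supports, which `c`
records. -/
theorem reverse_eq_iff (O O' : Orientation E) {𝒮 : Set (E → ℝ)}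
    (h𝒮 : ∀ v ∈ 𝒮, ∀ e, v e ≠ 0 → v e = val O e) {c : E → ℝ}
    (hc : ∀ e, c e ≠ 0 → c e = val O e) (hc𝒮 : ∀ e, c e ≠ 0 ↔ ∃ v ∈ 𝒮, v e ≠ 0) :
    O'.1 = (O.1 \ ⋃ v ∈ 𝒮, arcs v) ∪ ⋃ v ∈ 𝒮, arcs (-v) ↔ val O' = val O - (2 : ℝ) • c := by
  have hs0 : ∀ s : ℤˣ, ((s : ℤ) : ℝ) ≠ 0 := fun s => by
    rcases Int.units_eq_one_or s with rfl | rfl <;> simp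
  apply eq_setOf_iff
  intro e s
  simp only [Set.mem_union, Set.mem_sdiff, Set.mem_iUnion, arcs, Set.mem_ofPred_eq, mem_iff_val,
    Pi.neg_apply, Pi.sub_apply, Pi.smul_apply, smul_eq_mul, exists_prop]
  by_cases he : c e = 0
  · have hno : ∀ v ∈ 𝒮, v e = 0 := fun v hv => by
      by_contra hve
      exact (hc𝒮 e).2 ⟨v, hv, hve⟩ he
    rw [he, mul_zero, sub_zero]
    constructor
    · rintro (h | ⟨v, hv, h⟩)
      · exact h.1
      · rw [hno v hv, neg_zero] at h
        exact absurd h.symm (hs0 s)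
    · intro h
      refine Or.inl ⟨h, fun ⟨v, hv, h'⟩ => hs0 s ?_⟩
      rw [← h', hno v hv]
  · rw [hc e he]
    obtain ⟨v, hv, hve⟩ := (hc𝒮 e).1 he
    have h1 := h𝒮 v hv e hve
    constructor
    · rintro (h | ⟨u, hu, h⟩)
      · exact absurd ⟨v, hv, h1.trans h.1.symm⟩ h.2
      · have hue : u e ≠ 0 := fun h0 => hs0 s (by rw [← h, h0, neg_zero])
        rw [← h, h𝒮 u hu e hue]; ring
    · intro h
      exact Or.inr ⟨v, hv, by rw [h, h1]; ring⟩

/-- Relations on `±1`-vectors and on orientations generate the same equivalence. -/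
theorem eqvGen_val_iff {R : (E → ℝ) → (E → ℝ) → Prop} {r : Orientation E → Orientation E → Prop}
    (hR : ∀ o o', R o o' → (IsOrient o ↔ IsOrient o'))
    (hr : ∀ O O', r O O' ↔ R (val O) (val O')) (O O' : Orientation E) :
    Relation.EqvGen r O O' ↔ Relation.EqvGen R (val O) (val O') := by
  constructor
  · intro h
    induction h with
    | rel _ _ h => exact Relation.EqvGen.rel _ _ ((hr _ _).1 h)
    | refl => exact Relation.EqvGen.refl _
    | symm _ _ _ ih => exact Relation.EqvGen.symm _ _ ih
    | trans _ _ _ _ _ ih ih' => exact Relation.EqvGen.trans _ _ _ ih ih'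
  · have hor : ∀ o o', Relation.EqvGen R o o' → (IsOrient o ↔ IsOrient o') := by
      intro o o' h
      induction h with
      | rel _ _ h => exact hR _ _ h
      | refl => rfl
      | symm _ _ _ ih => exact ih.symm
      | trans _ _ _ _ _ ih ih' => exact ih.trans ih'
    -- A chain of vectors starting at an orientation consists of orientations, so its intermediate
    -- vectors lift.
    have key : ∀ o o', Relation.EqvGen R o o' → ∀ O O', val O = o → val O' = o' →
        Relation.EqvGen r O O' := by
      intro o o' h
      induction h with
      | rel _ _ h => rintro O O' rfl rfl; exact Relation.EqvGen.rel _ _ ((hr _ _).2 h)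
      | refl => rintro O O' rfl h; rw [val_injective h]; exact Relation.EqvGen.refl _
      | symm _ _ _ ih => exact fun O O' h h' => Relation.EqvGen.symm _ _ (ih O' O h' h)
      | trans x y z hxy hyz ih ih' =>
        rintro O O' rfl h'
        obtain ⟨O₁, hO₁⟩ := exists_val_eq ((hor _ _ hxy).1 (isOrient_val O))
        exact Relation.EqvGen.trans _ _ _ (ih O O₁ rfl hO₁) (ih' O₁ O' hO₁ h')
    exact fun h => key _ _ h O O' rfl rfl

/-- The fourientation is recovered from the basis and its orientation, so the atlas conditions
become sign conditions. -/
theorem val_basisMap_external {N : Matroid E} (A : ExternalAtlas N) (A' : InternalAtlas N)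
    (B : Base N) (e : E) (s : ℤˣ) :
    (e, s) ∈ A.fou B ↔ e ∈ B.1 ∨ ((s : ℤ) : ℝ) = val (basisMap A A' B) e := by
  rw [← mem_iff_val]
  change _ ↔ _ ∨ (e, s) ∈ A.fou B ∧ (e, s) ∈ A'.fou B
  by_cases he : e ∈ B.1
  · simp [he, A.internal B e he s]
  · simp [he, A'.external B e he s]

theorem val_basisMap_internal {N : Matroid E} (A : ExternalAtlas N) (A' : InternalAtlas N)
    (B : Base N) (e : E) (s : ℤˣ) :
    (e, s) ∈ A'.fou B ↔ e ∉ B.1 ∨ ((s : ℤ) : ℝ) = val (basisMap A A' B) e := by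
  rw [← mem_iff_val]
  change _ ↔ _ ∨ (e, s) ∈ A.fou B ∧ (e, s) ∈ A'.fou B
  by_cases he : e ∈ B.1
  · simp [he, A.internal B e he s]
  · simp [he, A'.external B e he s]

end Orientations

end RegularMatroid

namespace RegularMatroid

/-! ### Translating reversals and atlases to the pair of kernel and row space -/

section Translation

variable {E m : Type*} {N : Matroid E} {V W : Submodule ℝ (E → ℝ)} (M : Matrix m E ℝ)

theorem isSignedCircuit_iff [Fintype E] {v : E → ℝ} :
    IsSignedCircuit M N v ↔ SignedCircuitIn N (LinearMap.ker M.mulVecLin) v :=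
  ⟨fun h => ⟨h.1, h.2.1, h.2.2⟩, fun h => ⟨h.1, h.2, h.3⟩⟩

theorem isSignedCocircuit_iff [Fintype m] {v : E → ℝ} :
    IsSignedCocircuit M N v ↔ SignedCircuitIn N✶ (LinearMap.range Mᵀ.mulVecLin) v :=
  ⟨fun h => ⟨h.1, h.2.1, h.2.2⟩, fun h => ⟨h.1, h.2, h.3⟩⟩

theorem reversal_iff_circuitStep (O O' : Orientation E) :
    (∃ v, SignedCircuitIn N V v ∧ arcs v ⊆ O.1 ∧ O'.1 = (O.1 \ arcs v) ∪ arcs (-v)) ↔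
      CircuitStep N V (val O) (val O') := by
  refine exists_congr fun v => and_congr_right fun hv => ?_
  rw [arcs_subset_iff hv.sign]
  refine and_congr_right fun hvO => ?_
  have := reverse_eq_iff O O' (𝒮 := {v}) (by simpa using hvO) (c := v) hvO (by simp)
  simpa using this

theorem circuitReversal_iff [Fintype E] (O O' : Orientation E) :
    CircuitReversal M N O O' ↔ CircuitStep N (LinearMap.ker M.mulVecLin) (val O) (val O') := by
  simp only [CircuitReversal, isSignedCircuit_iff, reversal_iff_circuitStep]

theorem cocircuitReversal_iff [Fintype m] (O O' : Orientation E) :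
    CocircuitReversal M N O O' ↔
      CircuitStep N✶ (LinearMap.range Mᵀ.mulVecLin) (val O) (val O') := by
  simp only [CocircuitReversal, isSignedCocircuit_iff, reversal_iff_circuitStep]

theorem circuitStep_isOrient_iff {o o' : E → ℝ} (h : CircuitStep N V o o') :
    IsOrient o ↔ IsOrient o' :=
  ⟨h.isOrient, h.symm.isOrient⟩

theorem sameCircuitClass_iff [Fintype E] (O O' : Orientation E) :
    SameCircuitClass M N O O' ↔
      Relation.EqvGen (CircuitStep N (LinearMap.ker M.mulVecLin)) (val O) (val O') :=
  eqvGen_val_iff (fun _ _ => circuitStep_isOrient_iff) (circuitReversal_iff M) O O'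

theorem sameCocircuitClass_iff [Fintype m] (O O' : Orientation E) :
    SameCocircuitClass M N O O' ↔
      Relation.EqvGen (CircuitStep N✶ (LinearMap.range Mᵀ.mulVecLin)) (val O) (val O') :=
  eqvGen_val_iff (fun _ _ => circuitStep_isOrient_iff) (cocircuitReversal_iff M) O O'

theorem sameCircuitCocircuitClass_iff [Fintype E] [Fintype m] (O O' : Orientation E) :
    SameCircuitCocircuitClass M N O O' ↔
      Relation.EqvGen (Step N (LinearMap.ker M.mulVecLin) (LinearMap.range Mᵀ.mulVecLin))
        (val O) (val O') :=
  eqvGen_val_iff (fun _ _ h => ⟨h.isOrient, h.symm.isOrient⟩)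
    (fun O O' => by rw [circuitReversal_iff, cocircuitReversal_iff, Step]) O O'

/-- Disjoint families are replaced by their sums `c` and `d`, and recovered by decomposing these;
only the supports of the sums enter the image. -/
theorem differBy_iff [Fintype E] [Fintype m]
    (h : RegularPair N (LinearMap.ker M.mulVecLin) (LinearMap.range Mᵀ.mulVecLin))
    (O O' : Orientation E) (X Y : Set E) :
    (∃ 𝒞 𝒟, DifferBy M N O O' 𝒞 𝒟 ∧ X = ⋃ v ∈ 𝒞, Function.support v ∧
      Y = ⋃ v ∈ 𝒟, Function.support v) ↔
    ∃ c d, ReversesTo (LinearMap.ker M.mulVecLin) (LinearMap.range Mᵀ.mulVecLin) (val O) c d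
      (val O') ∧ X = Function.support c ∧ Y = Function.support d := by
  have key : ∀ {c d : E → ℝ} {𝒞 𝒟 : Set (E → ℝ)},
      (∀ v ∈ 𝒞, ∀ e, v e ≠ 0 → v e = val O e) → (∀ v ∈ 𝒟, ∀ e, v e ≠ 0 → v e = val O e) →
      (∀ e, c e ≠ 0 ↔ ∃ v ∈ 𝒞, v e ≠ 0) → (∀ e, d e ≠ 0 ↔ ∃ v ∈ 𝒟, v e ≠ 0) →
      (∀ e, c e ≠ 0 → c e = val O e) → (∀ e, d e ≠ 0 → d e = val O e) →
      (∀ e, c e = 0 ∨ d e = 0) →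
      (O'.1 = (O.1 \ ⋃ v ∈ 𝒞 ∪ 𝒟, arcs v) ∪ ⋃ v ∈ 𝒞 ∪ 𝒟, arcs (-v) ↔
        val O' = val O - (2 : ℝ) • c - (2 : ℝ) • d) := by
    intro c d 𝒞 𝒟 h1 h2 hc hd hcO hdO hcd
    rw [reverse_eq_iff O O' (𝒮 := 𝒞 ∪ 𝒟) (fun v hv => hv.elim (h1 v) (h2 v)) (c := c + d)
      (fun e he => ?_) (fun e => ?_)]
    · rw [smul_add, sub_sub]
    · rcases hcd e with h0 | h0 <;> simp only [Pi.add_apply, h0, zero_add, add_zero] at he ⊢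
      · exact hdO e he
      · exact hcO e he
    · simp only [Set.mem_union, or_and_right, exists_or, ← hc, ← hd]
      rcases hcd e with h0 | h0 <;> simp [h0]
  have hsupp : ∀ {c : E → ℝ} {𝒞 : Set (E → ℝ)}, (∀ e, c e ≠ 0 ↔ ∃ v ∈ 𝒞, v e ≠ 0) →
      ⋃ v ∈ 𝒞, Function.support v = Function.support c := by
    intro c 𝒞 hc
    ext e
    simp [hc]
  constructor
  · rintro ⟨𝒞, 𝒟, hD, rfl, rfl⟩
    have h1 : ∀ v ∈ 𝒞, v ∈ LinearMap.ker M.mulVecLin ∧ ∀ e, v e ≠ 0 → v e = val O e :=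
      fun v hv => ⟨(hD.circuit v hv).1.2.1,
        (arcs_subset_iff (hD.circuit v hv).1.1 O).1 (hD.circuit v hv).2⟩
    have h2 : ∀ v ∈ 𝒟, v ∈ LinearMap.range Mᵀ.mulVecLin ∧ ∀ e, v e ≠ 0 → v e = val O e :=
      fun v hv => ⟨(hD.cocircuit v hv).1.2.1,
        (arcs_subset_iff (hD.cocircuit v hv).1.1 O).1 (hD.cocircuit v hv).2⟩
    obtain ⟨c, hc, hcO, hc𝒞⟩ :=
      exists_sum_of_pairwiseDisjoint (isOrient_val O) h1 hD.disjoint_circuits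
    obtain ⟨d, hd, hdO, hd𝒟⟩ :=
      exists_sum_of_pairwiseDisjoint (isOrient_val O) h2 hD.disjoint_cocircuits
    have hcd : ∀ e, c e = 0 ∨ d e = 0 := by
      intro e
      by_contra! hcd
      obtain ⟨v, hv, hve⟩ := (hc𝒞 e).1 hcd.1
      obtain ⟨w, hw, hwe⟩ := (hd𝒟 e).1 hcd.2
      exact Set.disjoint_left.1 (hD.disjoint_circuit_cocircuit v hv w hw) hve hwe
    exact ⟨c, d, ⟨⟨hc, hd, hcO, hdO, hcd⟩, (key (fun v hv => (h1 v hv).2) (fun v hv => (h2 v hv).2)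
      hc𝒞 hd𝒟 hcO hdO hcd).1 hD.eq⟩, hsupp hc𝒞, hsupp hd𝒟⟩
  · rintro ⟨c, d, ⟨hr, hO'⟩, rfl, rfl⟩
    obtain ⟨⟨𝒞, hC, hCd, hCs⟩, -⟩ := h.left.exists_decomposition c hr.mem_left
      (hr.isSignVector_left (isOrient_val O)) _ hr.conf_left
    obtain ⟨⟨𝒟, hD, hDd, hDs⟩, -⟩ := h.right.exists_decomposition d hr.mem_right
      (hr.dual.isSignVector_left (isOrient_val O)) _ hr.conf_right
    have hc𝒞 : ∀ e, c e ≠ 0 ↔ ∃ v ∈ 𝒞, v e ≠ 0 := fun e =>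
      ⟨hCs e, fun ⟨v, hv, hve⟩ => by rwa [← (hC v hv).2 e hve]⟩
    have hd𝒟 : ∀ e, d e ≠ 0 ↔ ∃ v ∈ 𝒟, v e ≠ 0 := fun e =>
      ⟨hDs e, fun ⟨v, hv, hve⟩ => by rwa [← (hD v hv).2 e hve]⟩
    have h1 : ∀ v ∈ 𝒞, ∀ e, v e ≠ 0 → v e = val O e := fun v hv e hve => by
      rw [(hC v hv).2 e hve, hr.conf_left e ((hc𝒞 e).2 ⟨v, hv, hve⟩)]
    have h2 : ∀ v ∈ 𝒟, ∀ e, v e ≠ 0 → v e = val O e := fun v hv e hve => by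
      rw [(hD v hv).2 e hve, hr.conf_right e ((hd𝒟 e).2 ⟨v, hv, hve⟩)]
    refine ⟨𝒞, 𝒟, ⟨fun v hv => ⟨(isSignedCircuit_iff M).2 (hC v hv).1,
      (arcs_subset_iff (hC v hv).1.sign O).2 (h1 v hv)⟩,
      fun v hv => ⟨(isSignedCocircuit_iff M).2 (hD v hv).1,
      (arcs_subset_iff (hD v hv).1.sign O).2 (h2 v hv)⟩, hCd, hDd,
      fun v hv w hw => Set.disjoint_left.2 fun e he he' => ?_,
      (key h1 h2 hc𝒞 hd𝒟 hr.conf_left hr.conf_right hr.disj).2 hO'⟩,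
      (hsupp hc𝒞).symm, (hsupp hd𝒟).symm⟩
    exact (hr.disj e).elim ((hc𝒞 e).2 ⟨v, hv, he⟩) ((hd𝒟 e).2 ⟨w, hw, he'⟩)

theorem isExtendedValue_iff [Fintype E] [Fintype m]
    (h : RegularPair N (LinearMap.ker M.mulVecLin) (LinearMap.range Mᵀ.mulVecLin))
    (A : ExternalAtlas N) (A' : InternalAtlas N) (O : Orientation E) (S : Set E) :
    IsExtendedValue M A A' O S ↔ ∃ (B : Base N) (c d : E → ℝ),
      ReversesTo (LinearMap.ker M.mulVecLin) (LinearMap.range Mᵀ.mulVecLin)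
        (val (basisMap A A' B)) c d (val O) ∧ S = tileSet B.1 c d := by
  refine exists_congr fun B => ?_
  constructor
  · rintro ⟨𝒞, 𝒟, -, hD, rfl⟩
    obtain ⟨c, d, hr, hX, hY⟩ := (differBy_iff M h _ O _ _).1 ⟨𝒞, 𝒟, hD, rfl, rfl⟩
    exact ⟨c, d, hr, by rw [hX, hY, tileSet]⟩
  · rintro ⟨c, d, hr, rfl⟩
    obtain ⟨𝒞, 𝒟, hD, hX, hY⟩ := (differBy_iff M h _ O _ _).2 ⟨c, d, hr, rfl, rfl⟩
    refine ⟨𝒞, 𝒟, ?_, hD, by rw [← hX, ← hY, tileSet]⟩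
    rw [sameCircuitCocircuitClass_iff]
    exact hr.eqvGen h (isOrient_val _)

/-- If two orientations of different bases are modified by reversals, the results are separated
by an edge. -/
theorem not_tile_of_ne [Fintype E] [Fintype m]
    (h : RegularPair N (LinearMap.ker M.mulVecLin) (LinearMap.range Mᵀ.mulVecLin))
    {A : ExternalAtlas N} {A' : InternalAtlas N} (hA : A.Dissecting M) (hA' : A'.Dissecting M)
    (hT : A.Triangulating M ∨ A'.Triangulating M) {B₁ B₂ : Base N} (hne : B₁ ≠ B₂)
    {c₁ d₁ c₂ d₂ o₁ o₂ : E → ℝ}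
    (h₁ : ReversesTo (LinearMap.ker M.mulVecLin) (LinearMap.range Mᵀ.mulVecLin)
      (val (basisMap A A' B₁)) c₁ d₁ o₁)
    (h₂ : ReversesTo (LinearMap.ker M.mulVecLin) (LinearMap.range Mᵀ.mulVecLin)
      (val (basisMap A A' B₂)) c₂ d₂ o₂)
    (hno : ∀ e, o₁ e = o₂ e ∨ (e ∈ tileSet B₁.1 c₁ d₁ ↔ e ∈ tileSet B₂.1 c₂ d₂)) : False := by
  set f₁ := val (basisMap A A' B₁)
  set f₂ := val (basisMap A A' B₂)
  have hof₁ : IsOrient f₁ := isOrient_val _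
  have hof₂ : IsOrient f₂ := isOrient_val _
  obtain ⟨hr₁, rfl⟩ := h₁
  obtain ⟨hr₂, rfl⟩ := h₂
  have hneg : ∀ {x y : ℝ}, (x = 1 ∨ x = -1) → (y = 1 ∨ y = -1) → x ≠ y → y = -x := by
    rintro x y (rfl | rfl) (rfl | rfl) h <;> simp at h ⊢
  have hext : ∀ {B : Base N} {e : E} {s : ℤˣ}, (e, s) ∉ A.fou B →
      e ∉ B.1 ∧ val (basisMap A A' B) e = -((s : ℤ) : ℝ) := by
    intro B e s hs
    rw [val_basisMap_external A A', not_or] at hs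
    refine ⟨hs.1, hneg ?_ (isOrient_val _ e) hs.2⟩
    rcases Int.units_eq_one_or s with rfl | rfl <;> simp
  have hint : ∀ {B : Base N} {e : E} {s : ℤˣ}, (e, s) ∉ A'.fou B →
      e ∈ B.1 ∧ val (basisMap A A' B) e = -((s : ℤ) : ℝ) := by
    intro B e s hs
    rw [val_basisMap_internal A A', not_or, not_not] at hs
    refine ⟨hs.1, hneg ?_ (isOrient_val _ e) hs.2⟩
    rcases Int.units_eq_one_or s with rfl | rfl <;> simp
  have hcast : ∀ s : ℤˣ, -(((-s : ℤˣ) : ℤ) : ℝ) = ((s : ℤ) : ℝ) := fun s => by simp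
  have hsign : ∀ {v : E → ℝ}, IsSignVector v → ∀ e, v e ≠ 0 → ∃ s : ℤˣ, v e = ((s : ℤ) : ℝ) :=
    fun hv e he => (exists_unit ((hv e).resolve_left he)).imp fun _ => Eq.symm
  have hunit : ∀ s : ℤˣ, ((s : ℤ) : ℝ) ≠ 0 := fun s => by
    rcases Int.units_eq_one_or s with rfl | rfl <;> simp
  have hno' : ∀ e, f₁ e - 2 * c₁ e - 2 * d₁ e = f₂ e - 2 * c₂ e - 2 * d₂ e ∨
      (e ∈ tileSet B₁.1 c₁ d₁ ↔ e ∈ tileSet B₂.1 c₂ d₂) := hno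
  rcases hT with hT | hT
  · obtain ⟨C, hC, hCs⟩ := hA' B₁ B₂ hne
    rw [isSignedCircuit_iff] at hC
    refine h.not_tile B₁.2.indep hof₁ hof₂ hr₁ hr₂ hC (fun e he => ?_) (fun v hv => ?_) hno'
    · obtain ⟨s, hs⟩ := hsign hC.sign e he
      have h1 : ¬ ((e, s) ∈ A'.fou B₁ ∧ (e, -s) ∈ A'.fou B₂) := hCs (a := (e, s)) hs
      rw [not_and_or] at h1
      rw [hs]
      refine h1.imp (fun h => hint h) fun h => ?_
      have h2 := hint h
      rwa [hcast] at h2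
    · by_contra hcon
      refine hT B₁ B₂ hne ⟨v, (isSignedCircuit_iff M).2 hv, ?_⟩
      rintro ⟨e, s⟩ (hs : v e = ((s : ℤ) : ℝ))
      by_contra hmem
      have h1 : ¬ ((e, s) ∈ A.fou B₁ ∧ (e, -s) ∈ A.fou B₂) := hmem
      rw [not_and_or] at h1
      refine hcon ⟨e, hs ▸ hunit s, ?_⟩
      rw [hs]
      refine h1.imp (fun h => hext h) fun h => ?_
      have h2 := hext h
      rwa [hcast] at h2
  · obtain ⟨D, hD, hDs⟩ := hA B₁ B₂ hne
    rw [isSignedCocircuit_iff] at hD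
    -- Dually, bases become their complements. `D` is negated because potential cocircuits lie in
    -- `-(Fᶜ)` and not in `F`.
    refine h.dual.not_tile (B₁ := B₁.1ᶜ) (B₂ := B₂.1ᶜ) (h.dual_indep_compl B₁.2) hof₁ hof₂
      hr₁.dual hr₂.dual hD.neg (fun e he => ?_) (fun v hv => ?_) fun e => ?_
    · have he' : D e ≠ 0 := by simpa using he
      obtain ⟨s, hs⟩ := hsign hD.sign e he'
      have h1 : ¬ ((e, -s) ∈ A.fou B₁ ∧ (e, - -s) ∈ A.fou B₂) := hDs (a := (e, s)) hs
      rw [not_and_or, neg_neg] at h1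
      rw [Pi.neg_apply, hs, neg_neg]
      refine h1.imp (fun h => ?_) fun h => hext h
      have h2 := hext h
      rwa [hcast] at h2
    · by_contra hcon
      refine hT B₁ B₂ hne ⟨-v, (isSignedCocircuit_iff M).2 hv.neg, ?_⟩
      rintro ⟨e, s⟩ (hs : -v e = ((s : ℤ) : ℝ))
      have hve : v e = -((s : ℤ) : ℝ) := by rw [← hs, neg_neg]
      by_contra hmem
      have h1 : ¬ ((e, -s) ∈ A'.fou B₁ ∧ (e, - -s) ∈ A'.fou B₂) := fun h => hmem fun h' => h' h
      rw [not_and_or, neg_neg] at h1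
      refine hcon ⟨e, hve ▸ neg_ne_zero.2 (hunit s), ?_⟩
      rw [hve, neg_neg, Set.mem_compl_iff, Set.mem_compl_iff, not_not, not_not]
      refine h1.imp (fun h => ?_) fun h => hint h
      have h2 := hint h
      rwa [hcast] at h2
    · rw [hr₁.tileSet_dual, hr₂.tileSet_dual]
      refine (hno' e).imp (fun h => by linarith) fun h => ?_
      rw [Set.mem_compl_iff, Set.mem_compl_iff, h]

/-- Composing `F` with the basis invariant gives an injective self-map of the finite set of bases,
hence a surjective one: every class contains some `F B`. -/
theorem existsUnique_base [Fintype E] [Fintype m]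
    (h : RegularPair N (LinearMap.ker M.mulVecLin) (LinearMap.range Mᵀ.mulVecLin))
    {F : Base N → Orientation E}
    (hF : ∀ B B', SameCircuitCocircuitClass M N (F B) (F B') → B = B') (O : Orientation E) :
    ∃! B, SameCircuitCocircuitClass M N (F B) O := by
  obtain ⟨β, hβ⟩ := h.exists_base_invariant
  have hβ' : ∀ O O', β (val O) = β (val O') → SameCircuitCocircuitClass M N O O' := fun O O' hO =>
    (sameCircuitCocircuitClass_iff M O O').2 (hβ _ _ (isOrient_val O) (isOrient_val O') hO)
  have hinj : Function.Injective fun B => β (val (F B)) := fun B B' hB => hF B B' (hβ' _ _ hB)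
  obtain ⟨B, hB⟩ := Finite.injective_iff_surjective.1 hinj (β (val O))
  refine ⟨B, hβ' _ _ hB, fun B' hB' => hF B' B ?_⟩
  exact Relation.EqvGen.trans _ _ _ hB' (Relation.EqvGen.symm _ _ (hβ' _ _ hB))

theorem bijective_of_tiling [Fintype E] {φ : Orientation E → Set E} (hφ : Tiling φ) : Function.Bijective φ := by
  have hinj : Function.Injective φ := fun O O' hO => by
    by_contra hne
    obtain ⟨e, -, he⟩ := hφ O O' hne
    simp [hO] at he
  let ψ : Orientation E → Set E := fun O => {e | val O e = 1}
  have hψ : Function.Bijective ψ := by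
    constructor
    · intro O O' hO
      apply val_injective
      ext e
      have h1 : val O e = 1 ↔ val O' e = 1 := Set.ext_iff.1 hO e
      rcases isOrient_val O e with h | h <;> rcases isOrient_val O' e with h' | h' <;>
        rw [h, h'] at h1 <;> rw [h, h'] <;> norm_num at h1
    · intro S
      classical
      obtain ⟨O, hO⟩ := exists_val_eq (o := fun e => if e ∈ S then 1 else -1) fun e => by
        dsimp only
        split_ifs <;> simp
      refine ⟨O, ?_⟩
      ext e
      change val O e = 1 ↔ _
      rw [hO]
      dsimp only
      split_ifs with h <;> simp [h]
      norm_num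
  let ε := Equiv.ofBijective ψ hψ
  refine ⟨hinj, fun S => ?_⟩
  obtain ⟨T, hT⟩ := Finite.injective_iff_surjective.1 (hinj.comp ε.symm.injective) S
  exact ⟨_, hT⟩

end Translation

end RegularMatroid

/-! ### The theorem -/

open RegularMatroid in
theorem theorem1p8 {E m : Type*} [Fintype E] [Fintype m]
    (M : Matrix m E ℝ) (N : Matroid E)
    (hM : M.IsTotallyUnimodular) (hMN : RegularMatroid.Represents M N)
    (A : RegularMatroid.ExternalAtlas N) (A' : RegularMatroid.InternalAtlas N)
    (hA : A.Dissecting M) (hA' : A'.Dissecting M)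
    (hT : A.Triangulating M ∨ A'.Triangulating M) :
    (∀ O : RegularMatroid.Orientation E, ∃! B : RegularMatroid.Base N,
      RegularMatroid.SameCircuitCocircuitClass M N (RegularMatroid.basisMap A A' B) O) ∧
    ∃ φ : RegularMatroid.Orientation E ≃ Set E,
      (∀ (O : RegularMatroid.Orientation E) (S : Set E),
        RegularMatroid.IsExtendedValue M A A' O S ↔ S = φ O) ∧
      RegularMatroid.Tiling φ ∧
      RegularMatroid.IsRepresentativeSet (RegularMatroid.SameCircuitClass M N)
        (φ.symm '' {S | N.Indep S}) ∧
      RegularMatroid.IsRepresentativeSet (RegularMatroid.SameCocircuitClass M N)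
        (φ.symm '' {S | N.Spanning S}) := by
  have h := regularPair_of_isTotallyUnimodular M N hM hMN
  set V := LinearMap.ker M.mulVecLin
  set W := LinearMap.range Mᵀ.mulVecLin
  set F : Base N → E → ℝ := fun B => val (basisMap A A' B)
  have hF : ∀ B, IsOrient (F B) := fun B => isOrient_val _
  have huniq : ∀ B B', Relation.EqvGen (Step N V W) (F B) (F B') → B = B' := by
    intro B B' hBB'
    by_contra hne
    obtain ⟨c, d, hr⟩ := h.exists_reversible (hF B) hBB'
    -- If `F B` and `F B'` are equivalent, then `F B'` arises from both bases, from `B'` by the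
    -- empty reversal; with equal orientations no edge can separate.
    have hr' : ReversesTo V W (F B') 0 0 (F B') :=
      ⟨⟨V.zero_mem, W.zero_mem, by simp, by simp, by simp⟩, by simp⟩
    exact not_tile_of_ne M h hA hA' hT hne hr hr' fun e => Or.inl rfl
  have hbase := existsUnique_base M h (F := basisMap A A')
    fun B B' hBB' => huniq B B' ((sameCircuitCocircuitClass_iff M _ _).1 hBB')
  refine ⟨hbase, ?_⟩
  have hex : ∀ O, ∃ B c d, ReversesTo V W (F B) c d (val O) := fun O => by
    obtain ⟨B, hB, -⟩ := hbase O
    obtain ⟨c, d, hr⟩ := h.exists_reversible (hF B) ((sameCircuitCocircuitClass_iff M _ _).1 hB)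
    exact ⟨B, c, d, hr⟩
  have htile : ∀ {O O' : Orientation E} {B B' c c' d d'}, ReversesTo V W (F B) c d (val O) →
      ReversesTo V W (F B') c' d' (val O') →
      (∀ e, val O e = val O' e ∨ (e ∈ tileSet B.1 c d ↔ e ∈ tileSet B'.1 c' d')) →
      B = B' ∧ c = c' ∧ d = d' := by
    intro O O' B B' c c' d d' hr hr' hno
    obtain rfl : B = B' := by
      by_contra hne
      exact not_tile_of_ne M h hA hA' hT hne hr hr' hno
    rw [hr.2, hr'.2] at hno
    exact ⟨rfl, h.eq_of_tile B.2 (hF B) hr.1 hr'.1 hno⟩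
  choose Bs cs ds hrs using hex
  have htiling : Tiling fun O => tileSet (Bs O).1 (cs O) (ds O) := by
    intro O O' hne
    by_contra! hno
    obtain ⟨hB, hc, hd⟩ := htile (hrs O) (hrs O') fun e => by
      have := hno e
      rw [Ne, restrict_eq_iff, Set.mem_symmDiff] at this
      tauto
    exact hne (val_injective (by rw [(hrs O).2, (hrs O').2, hB, hc, hd]))
  let φ := Equiv.ofBijective _ (bijective_of_tiling htiling)
  -- Independence of choices: separation applied to `O` and itself leaves only one triple `(B, c,
  -- d)`.
  have hφ : ∀ {O B c d}, ReversesTo V W (F B) c d (val O) → φ O = tileSet B.1 c d := by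
    intro O B c d hr
    obtain ⟨hB, hc, hd⟩ := htile (hrs O) hr fun e => Or.inl rfl
    change tileSet (Bs O).1 (cs O) (ds O) = _
    rw [hB, hc, hd]
  have hex' : ∀ o, IsOrient o → ∃ B c d, ReversesTo V W (F B) c d o := fun o ho => by
    obtain ⟨O, rfl⟩ := exists_val_eq ho
    exact ⟨_, _, _, hrs O⟩
  have hpre : ∀ (p : Set E → Prop) O, O ∈ φ.symm '' {S | p S} ↔ p (φ O) := fun p O => 
    ⟨by rintro ⟨S, hS, rfl⟩; simpa using hS, fun hp => ⟨φ O, hp, φ.symm_apply_apply O⟩⟩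
  have hind : ∀ O, N.Indep (φ O) ↔ ∃ B d, ReversesTo V W (F B) 0 d (val O) := fun O =>
    ⟨fun hi => ⟨Bs O, ds O, by
      have h1 := ((hrs O).1.indep_tileSet_iff h (Bs O).2.indep).1 hi
      rw [← h1]; exact hrs O⟩,
    fun ⟨B, d, hr⟩ => by rw [hφ hr, hr.1.indep_tileSet_iff h B.2.indep]⟩
  have hspan : ∀ O, N.Spanning (φ O) ↔ ∃ B c, ReversesTo W V (F B) 0 c (val O) := fun O =>
    ⟨fun hi => ⟨Bs O, cs O, by
      have h1 := ((hrs O).1.spanning_tileSet_iff h (Bs O).2).1 hi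
      rw [← h1]; exact (hrs O).dual⟩,
    fun ⟨B, d, hr⟩ => by rw [hφ hr.dual, hr.dual.1.spanning_tileSet_iff h B.2]⟩
  have hlift : ∀ {Q : (E → ℝ) → Prop}, (∃! o, Q o) → (∀ o, Q o → IsOrient o) →
      ∃! O : Orientation E, Q (val O) := by
    rintro Q ⟨o, ho, hu⟩ hQ
    obtain ⟨O, rfl⟩ := exists_val_eq (hQ o ho)
    exact ⟨O, ho, fun O' hO' => val_injective (hu _ hO')⟩
  refine ⟨φ, fun O S => ?_, htiling, fun O => ?_, fun O => ?_⟩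
  · rw [isExtendedValue_iff M h]
    constructor
    · rintro ⟨B, c, d, hr, rfl⟩
      exact (hφ hr).symm
    · rintro rfl
      exact ⟨Bs O, cs O, ds O, hrs O, rfl⟩
  · simp only [hpre, hind, sameCircuitClass_iff]
    exact hlift (h.existsUnique_representative hF hex' huniq (isOrient_val O)) fun o ho =>
      (eqvGen_isOrient_iff (eqvGen_circuitStep_le (W := W) ho.2)).1 (isOrient_val O)
  · simp only [hpre, hspan, sameCocircuitClass_iff]
    refine hlift (h.dual.existsUnique_representative hF (fun o ho => ?_) (fun B B' hBB' => ?_)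
      (isOrient_val O)) fun o ho =>
      (eqvGen_isOrient_iff (eqvGen_circuitStep_le (W := V) ho.2)).1 (isOrient_val O)
    · obtain ⟨B, c, d, hr⟩ := hex' o ho
      exact ⟨B, d, c, hr.dual⟩
    · exact huniq B B' (Relation.EqvGen.mono (fun _ _ => step_dual_iff.1) _ _ hBB')
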